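/- Let $p \in [1,2]$ and $q \in [1,\infty]$ satisfy $\frac1p + \frac1q \ge 1$ (with $\frac1\infty = 0$). Then there exist a domain (connected open set) $\Omega \subset \mathbb{R}^2$ with $0 \in \Omega$, a Sobolev map $f \in W^{1,2}(\Omega, \mathbb{R}^2)$, and measurable functions $K \colon \Omega \to [1,\infty)$ and $\Sigma \colon \Omega \to [0,\infty)$ such that $f$ is continuous on $\Omega \setminus \{0\}$, $\lim_{x \to 0} |f(x)| = \infty$, $$ |Df(x)|^2 \le K(x) \det Df(x) + \Sigma(x) \qquad \text{for a.e. } x \in \Omega, $$ where $Df$ is the weak derivative of $f$ and $|Df(x)|$ is its operator norm, and such that simultaneously $$ K \in L^p(\Omega), \qquad \frac{\Sigma}{K} \in L^q(\Omega), \qquad \Sigma \in L^{q/2}(\Omega). $$ Here, for $0 < s < \infty$ (including $s < 1$), $\Sigma \in L^{s}(\Omega)$ means $\int_\Omega \Sigma^{s} < \infty$, and $L^{q/2} = L^\infty$ when $q = \infty$. -/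

import Mathlib

open MeasureTheory Filter Topology
open scoped ENNReal ContDiff

/-- `Df` is the weak (distributional) derivative of `f` on the open set `Ω`: both are locally
integrable on `Ω`, and integration by parts holds against every smooth real-valued test function
with compact support in `Ω`, in every direction `v`. -/
structure HasWeakFDerivOn {n m : ℕ} (Ω : Set (EuclideanSpace ℝ (Fin n)))
    (f : EuclideanSpace ℝ (Fin n) → EuclideanSpace ℝ (Fin m))
    (Df : EuclideanSpace ℝ (Fin n) →
      (EuclideanSpace ℝ (Fin n) →L[ℝ] EuclideanSpace ℝ (Fin m))) : Prop where
  locallyIntegrableOn : LocallyIntegrableOn f Ω volume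
  locallyIntegrableOn_deriv : LocallyIntegrableOn Df Ω volume
  integral_eq : ∀ φ : EuclideanSpace ℝ (Fin n) → ℝ,
    ContDiff ℝ ∞ φ → HasCompactSupport φ → tsupport φ ⊆ Ω →
    ∀ v : EuclideanSpace ℝ (Fin n),
      ∫ x in Ω, (fderiv ℝ φ x v) • f x = - ∫ x in Ω, φ x • Df x v

/-- The Sobolev space `W^{1,s}(Ω, ℝ^m)`: functions in `L^s(Ω)` which have a weak derivative
in `L^s(Ω)`. -/
def MemSobolevOne {n m : ℕ} (s : ℝ≥0∞) (Ω : Set (EuclideanSpace ℝ (Fin n)))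
    (f : EuclideanSpace ℝ (Fin n) → EuclideanSpace ℝ (Fin m)) : Prop :=
  MemLp f s (volume.restrict Ω) ∧
    ∃ Df : EuclideanSpace ℝ (Fin n) →
        (EuclideanSpace ℝ (Fin n) →L[ℝ] EuclideanSpace ℝ (Fin m)),
      HasWeakFDerivOn Ω f Df ∧ MemLp Df s (volume.restrict Ω)

/-- The set function `𝓜_n(K, S) : x ↦ {A : |A|^n ≤ K(x) det A + S(x)}`, where `|A|` is the operator
norm with respect to the Euclidean norm. -/
def distortionSet {n : ℕ} (K S : EuclideanSpace ℝ (Fin n) → ℝ)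
    (x : EuclideanSpace ℝ (Fin n)) :
    Set (EuclideanSpace ℝ (Fin n) →L[ℝ] EuclideanSpace ℝ (Fin n)) :=
  {A | ‖A‖ ^ n ≤ K x * A.det + S x}

/-- The differential inclusion `Df ∈ 𝓜_n(K, S)` on `Ω`: the weak derivative of `f`
(unique up to a null set) lies in `𝓜_n(K, S)(x)` for a.e. `x ∈ Ω`. -/
def SolvesDistortionInclusion {n : ℕ} (Ω : Set (EuclideanSpace ℝ (Fin n)))
    (f : EuclideanSpace ℝ (Fin n) → EuclideanSpace ℝ (Fin n))
    (K S : EuclideanSpace ℝ (Fin n) → ℝ) : Prop :=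
  ∃ Df : EuclideanSpace ℝ (Fin n) →
      (EuclideanSpace ℝ (Fin n) →L[ℝ] EuclideanSpace ℝ (Fin n)),
    HasWeakFDerivOn Ω f Df ∧
      ∀ᵐ x ∂(volume.restrict Ω), Df x ∈ distortionSet K S x

/-!
Hölder's inequality on the bounded domain reduces the question to the conjugate exponents
`1 / p = a`, `1 / q = 1 - a` with `a ∈ [1/2, 1]`. Everything is governed by the critically
integrable weight `J = (|x| t)⁻²`, where `t = log (1 / |x|)`: the construction has `|Df|² ≲ J`,
`K ≲ 1 + J ^ a` and `Σ ≲ J ^ (1 - a)`, so that `K ^ p` and `Σ ^ q` are controlled by `J`.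

The map folds a neighbourhood of the origin, along a spiral, into a strip of infinite length and
finite area. Let `φ = A(t) + θ` be a spiral phase (`θ` the polar angle), and let
`P = arcsin (sin φ)` be its triangle wave, whose slope `σ = sign (cos φ)` takes the values `1` and
`-1` on two interleaved spiral strips. The map is `f = (log t + g P, -g² t P)` with
`g = exp (a (log t - t)) / t`, and `A` is chosen with `A' = 1 / (t g)`. Then the radial derivative
`(1 + σ) / t` (in `t`, to leading order) of `log t + g P` cancels on the strip `σ = -1`, where
consequently `|Df| ≲ g / |x| = J ^ ((1 - a) / 2)` and the defect `Σ` alone suffices. On the strip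
`σ = 1` one only has `|Df| ≲ 1 / (t |x|) = J ^ (1/2)`, but there `det Df ≳ (g / |x|)²`, so
that a distortion of order `J ^ a` suffices (`spiral_coefficient_bounds`,
`spiralMap_distortion`).

The first component of `f` is `log log (1 / |x|)` up to a bounded term, hence `|f| → ∞` at the
origin. The map is locally Lipschitz off the origin; by Rademacher's theorem it is differentiable
almost everywhere, the ridges of the triangle wave are null (`ae_cosPhase_ne_zero`), and the
classical derivative is the weak derivative because `f / |x|` is integrable
(`hasWeakFDerivOn_fderiv_of_locallyLipschitzOn_diff`).
-/

/-! ### Weak derivatives of functions that are locally Lipschitz off a point -/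

theorem locallyLipschitzOn_of_hasStrictFDerivAt {E F : Type*} [NormedAddCommGroup E]
    [NormedSpace ℝ E] [NormedAddCommGroup F] [NormedSpace ℝ F] {f : E → F} {f' : E → E →L[ℝ] F}
    {s : Set E} (h : ∀ x ∈ s, HasStrictFDerivAt f (f' x) x) : LocallyLipschitzOn s f := by
  intro x hx
  obtain ⟨K, t, ht, hK⟩ := (h x hx).exists_lipschitzOnWith
  exact ⟨K, t, mem_nhdsWithin_of_mem_nhds ht, hK⟩

/-- Rademacher's theorem for locally Lipschitz functions on an open set. -/
theorem LocallyLipschitzOn.ae_differentiableAt {n : ℕ} {O : Set (EuclideanSpace ℝ (Fin n))}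
    (hO : IsOpen O) {u : EuclideanSpace ℝ (Fin n) → ℝ} (hu : LocallyLipschitzOn O u) :
    ∀ᵐ x, x ∈ O → DifferentiableAt ℝ u x := by
  have h0 : volume {x | ¬ (x ∈ O → DifferentiableAt ℝ u x)} = 0 := by
    refine measure_null_of_locally_null _ fun x hx => ?_
    simp only [Set.mem_ofPred_eq, Classical.not_imp] at hx
    obtain ⟨C, V, hV, hL⟩ := hu hx.1
    rw [hO.nhdsWithin_eq hx.1] at hV
    obtain ⟨W, hWV, hW, hxW⟩ := mem_nhds_iff.1 hV
    refine ⟨W ∩ {y | ¬ (y ∈ O → DifferentiableAt ℝ u y)}, ?_, ?_⟩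
    · rw [Set.inter_comm]
      exact inter_mem_nhdsWithin _ (hW.mem_nhds hxW)
    · have h := (hL.mono hWV).ae_differentiableWithinAt_of_mem (μ := volume)
      refine measure_mono_null (fun y hy => ?_) (ae_iff.1 h)
      simp only [Set.mem_inter_iff, Set.mem_ofPred_eq, Classical.not_imp] at hy ⊢
      exact ⟨hy.1, fun hd => hy.2.2 (hd.differentiableAt (hW.mem_nhds hy.1))⟩
  exact ae_iff.2 h0

/-- Integration by parts for a locally Lipschitz function on an open set. -/
theorem LocallyLipschitzOn.integral_fderiv_mul {n : ℕ} {O : Set (EuclideanSpace ℝ (Fin n))}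
    (hO : IsOpen O) {u : EuclideanSpace ℝ (Fin n) → ℝ} (hu : LocallyLipschitzOn O u)
    {φ : EuclideanSpace ℝ (Fin n) → ℝ} (hφ : ContDiff ℝ ∞ φ) (hc : HasCompactSupport φ)
    (hs : tsupport φ ⊆ O) (v : EuclideanSpace ℝ (Fin n)) :
    ∫ x, fderiv ℝ φ x v * u x = - ∫ x, φ x * fderiv ℝ u x v := by
  obtain ⟨L, hL, hφL, hLO⟩ := exists_compact_between hc hO hs
  obtain ⟨C, hC⟩ := (hu.mono hLO).exists_lipschitzOnWith_of_compact hL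
  obtain ⟨U, hU, hUu⟩ := hC.extend_real
  obtain ⟨D, hD⟩ := hφ.lipschitzWith_of_hasCompactSupport hc (by simp)
  have key := hU.integral_lineDeriv_mul_eq (μ := volume) hD hc v
  have hφd : Differentiable ℝ φ := hφ.differentiable (by simp)
  have e1 : ∀ x, lineDeriv ℝ φ x (-v) * U x = -(fderiv ℝ φ x v * u x) := fun x => by
    rw [(hφd x).lineDeriv_eq_fderiv, map_neg]
    by_cases hx : x ∈ L
    · rw [hUu hx]; ring
    · have : fderiv ℝ φ x = 0 := by
        by_contra h
        exact hx (interior_subset (hφL (support_fderiv_subset ℝ h)))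
      simp [this]
  have e2 : ∀ᵐ x, lineDeriv ℝ U x v * φ x = φ x * fderiv ℝ u x v := by
    filter_upwards [hU.ae_differentiableAt (μ := volume)] with x hx
    rw [hx.lineDeriv_eq_fderiv]
    by_cases hxs : x ∈ tsupport φ
    · have : U =ᶠ[𝓝 x] u := by
        filter_upwards [mem_interior_iff_mem_nhds.1 (hφL hxs)] with y hy using (hUu hy).symm
      rw [this.fderiv_eq, mul_comm]
    · simp [image_eq_zero_of_notMem_tsupport hxs]
  rw [integral_congr_ae e2] at key
  rw [key]
  simp only [e1, integral_neg, neg_neg]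

/-- A smooth cutoff vanishing near the origin, at scale `1 / (k + 1)`. -/
theorem exists_cutoff_origin (n : ℕ) : ∃ (η : ℕ → EuclideanSpace ℝ (Fin n) → ℝ) (C : ℝ),
    (∀ k, ContDiff ℝ ∞ (η k)) ∧ (∀ k, (0 : EuclideanSpace ℝ (Fin n)) ∉ tsupport (η k)) ∧
    (∀ k x, |η k x| ≤ 1) ∧ (∀ k x, ‖fderiv ℝ (η k) x‖ ≤ C * ‖x‖⁻¹) ∧
    (∀ x, x ≠ 0 → ∀ᶠ k in atTop, η k =ᶠ[𝓝 x] 1) := by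
  let ψ : ContDiffBump (0 : EuclideanSpace ℝ (Fin n)) := ⟨1, 2, by norm_num, by norm_num⟩
  have hψ : ContDiff ℝ ∞ ψ := ψ.contDiff
  obtain ⟨M, hM⟩ := (hψ.continuous_fderiv (by simp)).bounded_above_of_compact_support
    (ψ.hasCompactSupport.fderiv ℝ)
  have hM0 : 0 ≤ M := (norm_nonneg _).trans (hM 0)
  refine ⟨fun k x => 1 - ψ ((k + 1 : ℝ) • x), M * 2, fun k => ?_, fun k => ?_, fun k x => ?_,
    fun k x => ?_, fun x hx => ?_⟩
  · exact contDiff_const.sub (hψ.comp (contDiff_id.const_smul (k + 1 : ℝ)))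
  · rw [notMem_tsupport_iff_eventuallyEq]
    have h1 : ∀ᶠ y in 𝓝 (0 : EuclideanSpace ℝ (Fin n)), ψ y = 1 := ψ.eventuallyEq_one
    have h2 : Tendsto (fun x : EuclideanSpace ℝ (Fin n) => (k + 1 : ℝ) • x) (𝓝 0) (𝓝 0) := by
      have h : Continuous (fun x : EuclideanSpace ℝ (Fin n) => (k + 1 : ℝ) • x) :=
        continuous_const_smul _
      simpa using h.tendsto 0
    filter_upwards [h2.eventually h1] with y hy
    simp [hy]
  · have h1 := ψ.nonneg (x := (k + 1 : ℝ) • x)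
    have h2 := ψ.le_one (x := (k + 1 : ℝ) • x)
    rw [abs_le]; constructor <;> linarith
  · have hk : (0 : ℝ) < k + 1 := by positivity
    have hd : HasFDerivAt (fun x => 1 - ψ ((k + 1 : ℝ) • x))
        (-((fderiv ℝ ψ ((k + 1 : ℝ) • x)).comp ((k + 1 : ℝ) • ContinuousLinearMap.id ℝ _))) x := by
      have h1 := (hψ.differentiable (by simp) ((k + 1 : ℝ) • x)).hasFDerivAt
      have h2 : HasFDerivAt (fun y : EuclideanSpace ℝ (Fin n) => (k + 1 : ℝ) • y)
          ((k + 1 : ℝ) • ContinuousLinearMap.id ℝ _) x := (hasFDerivAt_id x).const_smul (k + 1 : ℝ)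
      exact (HasFDerivAt.comp x h1 h2).const_sub 1
    rw [hd.fderiv, norm_neg]
    by_cases hx : 2 < ‖(k + 1 : ℝ) • x‖
    · have h0 : fderiv ℝ ψ ((k + 1 : ℝ) • x) = 0 := by
        by_contra h
        have := support_fderiv_subset ℝ h
        rw [ψ.tsupport_eq, mem_closedBall_zero_iff] at this
        exact absurd this (not_le.2 hx)
      rw [h0]; simp; positivity
    · have hx2 : (k + 1 : ℝ) * ‖x‖ ≤ 2 := by
        rw [norm_smul, Real.norm_of_nonneg hk.le] at hx; exact not_lt.1 hx
      rcases eq_or_ne x 0 with rfl | hx0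
      · have h0 : fderiv ℝ ψ (0 : EuclideanSpace ℝ (Fin n)) = 0 :=
          (ψ.eventuallyEq_one.fderiv_eq).trans (by simp)
        simp [h0]
      have hxp : 0 < ‖x‖ := norm_pos_iff.2 hx0
      have hk2 : (k + 1 : ℝ) ≤ 2 * ‖x‖⁻¹ := by
        rw [← div_eq_mul_inv, le_div_iff₀ hxp]; exact hx2
      calc _ ≤ ‖fderiv ℝ ψ ((k + 1 : ℝ) • x)‖ *
              ‖(k + 1 : ℝ) • ContinuousLinearMap.id ℝ (EuclideanSpace ℝ (Fin n))‖ :=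
            ContinuousLinearMap.opNorm_comp_le _ _
        _ ≤ M * ((k + 1) * 1) := by
            refine mul_le_mul (hM _) ?_ (norm_nonneg _) hM0
            rw [norm_smul, Real.norm_of_nonneg hk.le]
            exact mul_le_mul_of_nonneg_left ContinuousLinearMap.norm_id_le hk.le
        _ ≤ M * 2 * ‖x‖⁻¹ := by
            rw [mul_one, mul_assoc]; exact mul_le_mul_of_nonneg_left hk2 hM0
  · have hxp : 0 < ‖x‖ := norm_pos_iff.2 hx
    obtain ⟨N, hN⟩ := exists_nat_gt (2 / ‖x‖)
    filter_upwards [eventually_ge_atTop N] with k hk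
    have hk' : (N : ℝ) ≤ k := by exact_mod_cast hk
    have hlt : 2 / (k + 1 : ℝ) < ‖x‖ := by
      rw [div_lt_iff₀ (by positivity)]
      rw [div_lt_iff₀ hxp] at hN
      nlinarith
    filter_upwards [continuous_norm.continuousAt.eventually (lt_mem_nhds hlt)] with y hy
    have : ψ ((k + 1 : ℝ) • y) = 0 := by
      apply ψ.zero_of_le_dist
      rw [dist_zero_right, norm_smul, Real.norm_of_nonneg (by positivity : (0 : ℝ) ≤ k + 1)]
      rw [div_lt_iff₀ (by positivity)] at hy
      change (2 : ℝ) ≤ _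
      linarith
    simp [this]

/-- A function which is locally Lipschitz off the origin, and whose singularity there is weak
enough for `u / |x|` to be integrable, has its classical derivative as weak derivative: cut off
the test function near the origin and let the scale of the cutoff tend to zero. -/
theorem integral_fderiv_mul_of_locallyLipschitzOn_diff {n : ℕ}
    {Ω : Set (EuclideanSpace ℝ (Fin n))} (hΩ : IsOpen Ω) [Nontrivial (EuclideanSpace ℝ (Fin n))]
    {u : EuclideanSpace ℝ (Fin n) → ℝ} (hu : LocallyLipschitzOn (Ω \ {0}) u)
    (hi : IntegrableOn u Ω) (hi' : IntegrableOn (fun x => ‖x‖⁻¹ * u x) Ω)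
    (hd : IntegrableOn (fderiv ℝ u) Ω)
    {φ : EuclideanSpace ℝ (Fin n) → ℝ} (hφ : ContDiff ℝ ∞ φ) (hc : HasCompactSupport φ)
    (hs : tsupport φ ⊆ Ω) (v : EuclideanSpace ℝ (Fin n)) :
    ∫ x in Ω, fderiv ℝ φ x v * u x = - ∫ x in Ω, φ x * fderiv ℝ u x v := by
  obtain ⟨η, C, hη, hη0, hη1, hηd, hηe⟩ := exists_cutoff_origin n
  have hO : IsOpen (Ω \ {0}) := hΩ.sdiff isClosed_singleton
  have hsupp : ∀ k, tsupport (fun x => η k x * φ x) ⊆ Ω \ {0} := fun k x hx =>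
    ⟨hs (tsupport_mul_subset_right hx), fun h0 => hη0 k
      (by rw [Set.mem_singleton_iff] at h0; rw [← h0]; exact tsupport_mul_subset_left hx)⟩
  have key : ∀ k, ∫ x in Ω, fderiv ℝ (fun x => η k x * φ x) x v * u x =
      - ∫ x in Ω, (η k x * φ x) * fderiv ℝ u x v := by
    intro k
    have h := hu.integral_fderiv_mul hO ((hη k).mul hφ) hc.mul_left (hsupp k) v
    have hsub : tsupport (fun x => η k x * φ x) ⊆ Ω := (hsupp k).trans Set.sdiff_subset
    rw [setIntegral_eq_integral_of_forall_compl_eq_zero,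
      setIntegral_eq_integral_of_forall_compl_eq_zero]
    · exact h
    · intro x hx
      have : η k x * φ x = 0 := image_eq_zero_of_notMem_tsupport (f := fun x => η k x * φ x)
        (fun h' => hx (hsub h'))
      simp [this]
    · intro x hx
      have : fderiv ℝ (fun x => η k x * φ x) x = 0 := by
        by_contra h'
        exact hx (hsub (support_fderiv_subset ℝ h'))
      simp [this]
  obtain ⟨M, hM⟩ := hφ.continuous.bounded_above_of_compact_support hc
  obtain ⟨M', hM'⟩ := (hφ.continuous_fderiv (by simp)).bounded_above_of_compact_support
    (hc.fderiv ℝ)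
  have hφd : Differentiable ℝ φ := hφ.differentiable (by simp)
  have hne : ∀ᵐ x ∂(volume.restrict Ω), x ≠ (0 : EuclideanSpace ℝ (Fin n)) :=
    ae_restrict_of_ae (Measure.ae_ne volume 0)
  have l1 : Tendsto (fun k => ∫ x in Ω, fderiv ℝ (fun x => η k x * φ x) x v * u x) atTop
      (𝓝 (∫ x in Ω, fderiv ℝ φ x v * u x)) := by
    refine tendsto_integral_of_dominated_convergence
      (fun x => (M' * ‖v‖) * ‖u x‖ + (M * C * ‖v‖) * ‖‖x‖⁻¹ * u x‖) (fun k => ?_) ?_ (fun k => ?_) ?_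
    · have : Continuous fun x => fderiv ℝ (fun x => η k x * φ x) x v :=
        (((hη k).mul hφ).continuous_fderiv (by simp)).clm_apply continuous_const
      exact this.aestronglyMeasurable.mul hi.aestronglyMeasurable
    · exact (hi.norm.const_mul _).add (hi'.norm.const_mul _)
    · refine Eventually.of_forall fun x => ?_
      rw [fderiv_fun_mul ((hη k).differentiable (by simp) x) (hφd x)]
      have b1 : ‖η k x * fderiv ℝ φ x v‖ ≤ M' * ‖v‖ := by
        rw [norm_mul]
        calc _ ≤ 1 * (M' * ‖v‖) := mul_le_mul (hη1 k x)
              (((fderiv ℝ φ x).le_opNorm v).trans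
                (mul_le_mul_of_nonneg_right (hM' x) (norm_nonneg _))) (norm_nonneg _) zero_le_one
          _ = _ := one_mul _
      have b2 : ‖φ x * fderiv ℝ (η k) x v‖ ≤ M * (C * ‖x‖⁻¹ * ‖v‖) := by
        rw [norm_mul]
        exact mul_le_mul (hM x) (((fderiv ℝ (η k) x).le_opNorm v).trans
            (mul_le_mul_of_nonneg_right (hηd k x) (norm_nonneg _))) (norm_nonneg _)
            ((norm_nonneg _).trans (hM x))
      have e : (η k x • fderiv ℝ φ x + φ x • fderiv ℝ (η k) x) v * u x
          = η k x * fderiv ℝ φ x v * u x + φ x * fderiv ℝ (η k) x v * u x := by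
        simp [add_mul]
      rw [e]
      refine (norm_add_le _ _).trans (add_le_add ?_ ?_)
      · rw [norm_mul _ (u x)]
        exact mul_le_mul_of_nonneg_right b1 (norm_nonneg _)
      · rw [norm_mul _ (u x), norm_mul ‖x‖⁻¹, norm_inv, norm_norm]
        calc _ ≤ M * (C * ‖x‖⁻¹ * ‖v‖) * ‖u x‖ := mul_le_mul_of_nonneg_right b2 (norm_nonneg _)
          _ = _ := by ring
    · filter_upwards [hne] with x hx
      refine tendsto_const_nhds.congr' ?_
      filter_upwards [hηe x hx] with k hk
      have : (fun x => η k x * φ x) =ᶠ[𝓝 x] φ := by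
        filter_upwards [hk] with y hy
        simp [hy]
      rw [this.fderiv_eq]
  have l2 : Tendsto (fun k => ∫ x in Ω, (η k x * φ x) * fderiv ℝ u x v) atTop
      (𝓝 (∫ x in Ω, φ x * fderiv ℝ u x v)) := by
    refine tendsto_integral_of_dominated_convergence
      (fun x => M * ‖v‖ * ‖fderiv ℝ u x‖) (fun k => ?_) ?_ (fun k => ?_) ?_
    · exact ((hη k).continuous.mul hφ.continuous).aestronglyMeasurable.mul
        (hd.aestronglyMeasurable.apply_continuousLinearMap v)
    · exact hd.norm.const_mul _
    · refine Eventually.of_forall fun x => ?_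
      rw [norm_mul, norm_mul]
      have b0 : ‖η k x‖ * ‖φ x‖ ≤ M := by
        calc _ ≤ 1 * M := mul_le_mul (hη1 k x) (hM x) (norm_nonneg _) zero_le_one
          _ = M := one_mul _
      calc _ ≤ M * (‖fderiv ℝ u x‖ * ‖v‖) :=
            mul_le_mul b0 ((fderiv ℝ u x).le_opNorm v) (norm_nonneg _)
              ((norm_nonneg _).trans (hM x))
        _ = _ := by ring
    · filter_upwards [hne] with x hx
      refine tendsto_const_nhds.congr' ?_
      filter_upwards [hηe x hx] with k hk
      have : η k x = 1 := hk.eq_of_nhds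
      rw [this, one_mul]
  have l3 := l2.neg
  simp only [← key] at l3
  exact tendsto_nhds_unique l1 l3

theorem LocallyLipschitzOn.mul_real {E : Type*} [PseudoMetricSpace E] {s : Set E} {f g : E → ℝ}
    (hf : LocallyLipschitzOn s f) (hg : LocallyLipschitzOn s g) :
    LocallyLipschitzOn s (fun x => f x * g x) := by
  intro x hx
  obtain ⟨K, t, ht, hK⟩ := hf hx
  obtain ⟨K', t', ht', hK'⟩ := hg hx
  have hxt := mem_of_mem_nhdsWithin hx ht
  have hxt' := mem_of_mem_nhdsWithin hx ht'
  have bound : ∀ {h : E → ℝ} {C : NNReal} {T : Set E}, LipschitzOnWith C h T → x ∈ T →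
      ∀ y ∈ T ∩ Metric.ball x 1, |h y| ≤ |h x| + C := by
    intro h C T hC hxT y hy
    have h1 := hC.dist_le_mul y hy.1 x hxT
    have h2 : dist y x ≤ 1 := (Metric.mem_ball.1 hy.2).le
    have h3 : (C : ℝ) * dist y x ≤ C := mul_le_of_le_one_right C.2 h2
    have h4 := abs_sub_abs_le_abs_sub (h y) (h x)
    rw [Real.dist_eq] at h1
    linarith
  refine ⟨(Real.toNNReal (|f x| + K)) * K' + (Real.toNNReal (|g x| + K')) * K,
    t ∩ t' ∩ Metric.ball x 1, inter_mem (inter_mem ht ht')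
      (mem_nhdsWithin_of_mem_nhds (Metric.ball_mem_nhds x one_pos)),
    LipschitzOnWith.of_dist_le_mul fun y hy z hz => ?_⟩
  have b1 := bound hK hxt y ⟨hy.1.1, hy.2⟩
  have b2 := bound hK' hxt' z ⟨hz.1.2, hz.2⟩
  have d1 := hK.dist_le_mul y hy.1.1 z hz.1.1
  have d2 := hK'.dist_le_mul y hy.1.2 z hz.1.2
  push_cast
  rw [Real.coe_toNNReal _ (by positivity), Real.coe_toNNReal _ (by positivity)]
  rw [Real.dist_eq] at *
  rw [show f y * g y - f z * g z = f y * (g y - g z) + g z * (f y - f z) by ring]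
  refine (abs_add_le _ _).trans ?_
  rw [abs_mul, abs_mul, add_mul, mul_assoc, mul_assoc]
  exact add_le_add (mul_le_mul b1 d2 (abs_nonneg _) (by positivity))
    (mul_le_mul b2 d1 (abs_nonneg _) (by positivity))

theorem hasWeakFDerivOn_fderiv_of_locallyLipschitzOn_diff {n m : ℕ}
    {Ω : Set (EuclideanSpace ℝ (Fin n))} (hΩ : IsOpen Ω) [Nontrivial (EuclideanSpace ℝ (Fin n))]
    {f : EuclideanSpace ℝ (Fin n) → EuclideanSpace ℝ (Fin m)}
    (hf : ∀ i, LocallyLipschitzOn (Ω \ {0}) (fun x => f x i))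
    (hi : IntegrableOn f Ω) (hi' : IntegrableOn (fun x => ‖x‖⁻¹ • f x) Ω)
    (hd : IntegrableOn (fderiv ℝ f) Ω) : HasWeakFDerivOn Ω f (fderiv ℝ f) := by
  refine ⟨hi.locallyIntegrableOn, hd.locallyIntegrableOn, fun φ hφ hc hs v => ?_⟩
  have hO : IsOpen (Ω \ {0}) := hΩ.sdiff isClosed_singleton
  let π : Fin m → EuclideanSpace ℝ (Fin m) →L[ℝ] ℝ := fun i => EuclideanSpace.proj i
  have hdiff : ∀ᵐ x ∂(volume.restrict Ω), DifferentiableAt ℝ f x := by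
    have h1 : ∀ᵐ x, ∀ i, x ∈ Ω \ {0} → DifferentiableAt ℝ (fun x => f x i) x :=
      ae_all_iff.2 fun i => (hf i).ae_differentiableAt hO
    filter_upwards [ae_restrict_of_ae h1, ae_restrict_of_ae (Measure.ae_ne volume 0),
      ae_restrict_mem hΩ.measurableSet] with x hx hx0 hxΩ
    exact differentiableAt_euclidean.2 fun i => hx i ⟨hxΩ, hx0⟩
  have hfd : ∀ i, ∀ᵐ x ∂(volume.restrict Ω),
      (π i).comp (fderiv ℝ f x) = fderiv ℝ (fun x => f x i) x := fun i => by
    filter_upwards [hdiff] with x hx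
    exact ((π i).hasFDerivAt.comp x hx.hasFDerivAt).fderiv.symm
  have hφb := hφ.continuous.bounded_above_of_compact_support hc
  have hφb' := (hφ.continuous_fderiv (by simp)).bounded_above_of_compact_support (hc.fderiv ℝ)
  obtain ⟨M, hM⟩ := hφb
  obtain ⟨M', hM'⟩ := hφb'
  have i1 : IntegrableOn (fun x => fderiv ℝ φ x v • f x) Ω := by
    refine Integrable.bdd_smul (φ := fun x => fderiv ℝ φ x v) hi (M' * ‖v‖) ?_ (Eventually.of_forall fun x => ?_)
    · exact ((hφ.continuous_fderiv (by simp)).clm_apply continuous_const).aestronglyMeasurable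
    · exact ((fderiv ℝ φ x).le_opNorm v).trans
        (mul_le_mul_of_nonneg_right (hM' x) (norm_nonneg _))
  have i2 : IntegrableOn (fun x => φ x • fderiv ℝ f x v) Ω := by
    exact Integrable.bdd_smul (hd.apply_continuousLinearMap v) M
      hφ.continuous.aestronglyMeasurable (Eventually.of_forall hM)
  ext i
  have e1 := (π i).integral_comp_comm i1
  have e2 := (π i).integral_comp_comm i2
  have i3 : IntegrableOn (fun x => (π i).comp (fderiv ℝ f x)) Ω :=
    (ContinuousLinearMap.compL ℝ (EuclideanSpace ℝ (Fin n)) (EuclideanSpace ℝ (Fin m)) ℝ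
      (π i)).integrable_comp hd
  have i4 : IntegrableOn (fun x => ‖x‖⁻¹ * f x i) Ω :=
    ((π i).integrable_comp hi').congr (Eventually.of_forall fun x => by simp [π])
  have key := integral_fderiv_mul_of_locallyLipschitzOn_diff hΩ (hf i)
    ((π i).integrable_comp hi) i4 (i3.congr (hfd i)) hφ hc hs v
  have e3 : ∫ x in Ω, φ x * fderiv ℝ (fun x => f x i) x v = ∫ x in Ω, π i (φ x • fderiv ℝ f x v) := by
    refine integral_congr_ae ?_
    filter_upwards [hfd i] with x hx
    rw [← hx]; simp
  change π i _ = -(π i _)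
  rw [← e1, ← e2, ← e3, ← key]
  simp [π]

/-! ### The triangle wave and planar linear algebra -/

/-- The triangle wave, as a function of a point `(c, s)` of the unit circle, is `arcsin s`; it is
Lipschitz although `arcsin` is not. -/
theorem abs_arcsin_sub_arcsin_le {c s c' s' : ℝ} (h : c ^ 2 + s ^ 2 = 1)
    (h' : c' ^ 2 + s' ^ 2 = 1) :
    |Real.arcsin s - Real.arcsin s'| ≤ Real.pi / 2 * (|s - s'| + |c - c'|) := by
  have bound : ∀ {c s : ℝ}, c ^ 2 + s ^ 2 = 1 →
      Real.sin (Real.arcsin s) = s ∧ Real.cos (Real.arcsin s) = |c| := by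
    intro c s h
    refine ⟨Real.sin_arcsin (by nlinarith [sq_nonneg c]) (by nlinarith [sq_nonneg c]), ?_⟩
    rw [Real.cos_arcsin, ← Real.sqrt_sq_eq_abs]
    congr 1; linarith
  obtain ⟨e1, e2⟩ := bound h
  obtain ⟨e1', e2'⟩ := bound h'
  set a := Real.arcsin s
  set a' := Real.arcsin s'
  have ha : |(a - a') / 2| ≤ Real.pi / 2 := by
    have := Real.neg_pi_div_two_le_arcsin s
    have := Real.arcsin_le_pi_div_two s
    have := Real.neg_pi_div_two_le_arcsin s'
    have := Real.arcsin_le_pi_div_two s'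
    rw [abs_le]; constructor <;> simp only [a, a'] <;> linarith
  have hj := Real.mul_abs_le_abs_sin ha
  -- the chord between the two points has length `2 |sin ((a - a') / 2)|`
  have hchord : (s - s') ^ 2 + (|c| - |c'|) ^ 2 = (2 * |Real.sin ((a - a') / 2)|) ^ 2 := by
    rw [← e1, ← e1', ← e2, ← e2', Real.sin_sub_sin, Real.cos_sub_cos,
      mul_pow 2 |Real.sin ((a - a') / 2)|, sq_abs]
    have := Real.sin_sq_add_cos_sq ((a + a') / 2)
    linear_combination (4 * Real.sin ((a - a') / 2) ^ 2) * this
  have hcc : (|c| - |c'|) ^ 2 ≤ |c - c'| ^ 2 := by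
    rw [← sq_abs (|c| - |c'|)]
    exact pow_le_pow_left₀ (abs_nonneg _) (abs_abs_sub_abs_le_abs_sub c c') 2
  have h2 : 2 * |Real.sin ((a - a') / 2)| ≤ |s - s'| + |c - c'| := by
    refine abs_le_of_sq_le_sq' ?_ (by positivity) |>.2
    rw [← hchord]
    nlinarith [sq_abs (s - s'), mul_nonneg (abs_nonneg (s - s')) (abs_nonneg (c - c'))]
  rw [abs_div, abs_two] at hj
  have hpi := Real.pi_pos
  calc |a - a'| = Real.pi / 2 * (2 * (2 / Real.pi * (|a - a'| / 2))) := by field_simp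
    _ ≤ _ := by
      apply mul_le_mul_of_nonneg_left _ (by positivity)
      linarith

theorem EuclideanSpace.det_fin_two
    (L : EuclideanSpace ℝ (Fin 2) →L[ℝ] EuclideanSpace ℝ (Fin 2)) :
    L.det = L (EuclideanSpace.single 0 1) 0 * L (EuclideanSpace.single 1 1) 1
      - L (EuclideanSpace.single 1 1) 0 * L (EuclideanSpace.single 0 1) 1 := by
  have h := LinearMap.det_toMatrix (EuclideanSpace.basisFun (Fin 2) ℝ).toBasis
    (L : EuclideanSpace ℝ (Fin 2) →ₗ[ℝ] EuclideanSpace ℝ (Fin 2))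
  rw [ContinuousLinearMap.det, ← h, Matrix.det_fin_two]
  simp [LinearMap.toMatrix_apply]

theorem EuclideanSpace.norm_fin_two_le (y : EuclideanSpace ℝ (Fin 2)) :
    ‖y‖ ≤ |y 0| + |y 1| := by
  rw [EuclideanSpace.norm_eq]
  apply Real.sqrt_le_iff.2 ⟨by positivity, ?_⟩
  simp only [Fin.sum_univ_two, Real.norm_eq_abs]
  nlinarith [mul_nonneg (abs_nonneg (y 0)) (abs_nonneg (y 1))]

theorem norm_sq_fin_two (x : EuclideanSpace ℝ (Fin 2)) : ‖x‖ ^ 2 = x 0 ^ 2 + x 1 ^ 2 := by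
  rw [EuclideanSpace.norm_sq_eq]; simp

theorem abs_coord_combination_le (x v : EuclideanSpace ℝ (Fin 2)) :
    |x 0 * v 1 - x 1 * v 0| ≤ ‖x‖ * ‖v‖ ∧ |x 0 * v 0 + x 1 * v 1| ≤ ‖x‖ * ‖v‖ := by
  have h : (‖x‖ * ‖v‖) ^ 2 = (x 0 ^ 2 + x 1 ^ 2) * (v 0 ^ 2 + v 1 ^ 2) := by
    rw [mul_pow, norm_sq_fin_two, norm_sq_fin_two]
  constructor <;> refine abs_le_of_sq_le_sq ?_ (by positivity) <;> rw [h]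
  · nlinarith [sq_nonneg (x 0 * v 0 + x 1 * v 1)]
  · nlinarith [sq_nonneg (x 0 * v 1 - x 1 * v 0)]

theorem EuclideanSpace.abs_det_fin_two_le
    (L : EuclideanSpace ℝ (Fin 2) →L[ℝ] EuclideanSpace ℝ (Fin 2)) : |L.det| ≤ ‖L‖ ^ 2 := by
  have h := (abs_coord_combination_le (L (EuclideanSpace.single 0 1))
    (L (EuclideanSpace.single 1 1))).1
  have h0 := L.le_opNorm (EuclideanSpace.single 0 1)
  have h1 := L.le_opNorm (EuclideanSpace.single 1 1)
  simp only [PiLp.norm_single, norm_one, mul_one] at h0 h1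
  have e : L.det = L (EuclideanSpace.single 0 1) 0 * L (EuclideanSpace.single 1 1) 1 -
      L (EuclideanSpace.single 0 1) 1 * L (EuclideanSpace.single 1 1) 0 := by
    rw [EuclideanSpace.det_fin_two]; ring
  rw [e, sq]
  exact h.trans (mul_le_mul h0 h1 (norm_nonneg _) (norm_nonneg _))

/-! ### Logarithmic polar coordinates -/

/-- The logarithmic radius `t = log (1 / |x|)`. -/
noncomputable def logRadius (x : EuclideanSpace ℝ (Fin 2)) : ℝ := -Real.log ‖x‖

/-- The differential of the polar angle. -/
noncomputable def dAngle (x : EuclideanSpace ℝ (Fin 2)) : EuclideanSpace ℝ (Fin 2) →L[ℝ] ℝ :=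
  (x 0 / ‖x‖ ^ 2) • EuclideanSpace.proj 1 - (x 1 / ‖x‖ ^ 2) • EuclideanSpace.proj 0

/-- The differential of `logRadius`. -/
noncomputable def dLogRadius (x : EuclideanSpace ℝ (Fin 2)) : EuclideanSpace ℝ (Fin 2) →L[ℝ] ℝ :=
  -((x 0 / ‖x‖ ^ 2) • EuclideanSpace.proj 0 + (x 1 / ‖x‖ ^ 2) • EuclideanSpace.proj 1)

theorem exp_logRadius {x : EuclideanSpace ℝ (Fin 2)} (hx : x ≠ 0) :
    Real.exp (logRadius x) = ‖x‖⁻¹ := by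
  rw [logRadius, Real.exp_neg, Real.exp_log (norm_pos_iff.2 hx)]

theorem hasStrictFDerivAt_logRadius {x : EuclideanSpace ℝ (Fin 2)} (hx : x ≠ 0) :
    HasStrictFDerivAt logRadius (dLogRadius x) x := by
  have hn : ‖x‖ ^ 2 ≠ 0 := pow_ne_zero _ (norm_ne_zero_iff.2 hx)
  have h := ((hasStrictFDerivAt_norm_sq x).log hn).const_smul (-(1 / 2) : ℝ)
  have e : logRadius = fun x : EuclideanSpace ℝ (Fin 2) => (-(1 / 2) : ℝ) • Real.log (‖x‖ ^ 2) := by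
    funext y
    rw [logRadius, Real.log_pow, smul_eq_mul]; push_cast; ring
  rw [e]
  refine h.congr_fderiv (ContinuousLinearMap.ext fun v => ?_)
  simp [dLogRadius, PiLp.inner_apply, Fin.sum_univ_two]
  field_simp
  ring

theorem abs_dAngle_le (x v : EuclideanSpace ℝ (Fin 2)) : |dAngle x v| ≤ ‖x‖⁻¹ * ‖v‖ := by
  rcases eq_or_ne x 0 with rfl | hx
  · simp [dAngle]
  have hp : 0 < ‖x‖ := norm_pos_iff.2 hx
  have e : dAngle x v = (x 0 * v 1 - x 1 * v 0) / ‖x‖ ^ 2 := by simp [dAngle]; ring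
  rw [e, abs_div, abs_of_pos (by positivity : 0 < ‖x‖ ^ 2), div_le_iff₀ (by positivity)]
  calc _ ≤ ‖x‖ * ‖v‖ := (abs_coord_combination_le x v).1
    _ = _ := by field_simp

theorem abs_dLogRadius_le (x v : EuclideanSpace ℝ (Fin 2)) :
    |dLogRadius x v| ≤ ‖x‖⁻¹ * ‖v‖ := by
  rcases eq_or_ne x 0 with rfl | hx
  · simp [dLogRadius]
  have hp : 0 < ‖x‖ := norm_pos_iff.2 hx
  have e : dLogRadius x v = -((x 0 * v 0 + x 1 * v 1) / ‖x‖ ^ 2) := by simp [dLogRadius]; ring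
  rw [e, abs_neg, abs_div, abs_of_pos (by positivity : 0 < ‖x‖ ^ 2), div_le_iff₀ (by positivity)]
  calc _ ≤ ‖x‖ * ‖v‖ := (abs_coord_combination_le x v).2
    _ = _ := by field_simp

/-- The frame `dLogRadius`, `dAngle` is orthogonal with both vectors of length `1 / |x|`, and
reverses orientation. -/
theorem det_of_logPolar {x : EuclideanSpace ℝ (Fin 2)} (hx : x ≠ 0)
    {L : EuclideanSpace ℝ (Fin 2) →L[ℝ] EuclideanSpace ℝ (Fin 2)} {a₁ a₂ b₁ b₂ : ℝ}
    (h0 : ∀ v, L v 0 = a₁ * dLogRadius x v + a₂ * dAngle x v)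
    (h1 : ∀ v, L v 1 = b₁ * dLogRadius x v + b₂ * dAngle x v) :
    L.det = (a₂ * b₁ - a₁ * b₂) * (‖x‖⁻¹) ^ 2 := by
  have hn : ‖x‖ ^ 2 ≠ 0 := pow_ne_zero _ (norm_ne_zero_iff.2 hx)
  rw [EuclideanSpace.det_fin_two, h0, h0, h1, h1, inv_pow]
  simp [dAngle, dLogRadius]
  have := norm_sq_fin_two x
  field_simp
  rw [this]
  ring

theorem norm_le_of_logPolar {x : EuclideanSpace ℝ (Fin 2)}
    {L : EuclideanSpace ℝ (Fin 2) →L[ℝ] EuclideanSpace ℝ (Fin 2)} {a₁ a₂ b₁ b₂ : ℝ}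
    (h0 : ∀ v, L v 0 = a₁ * dLogRadius x v + a₂ * dAngle x v)
    (h1 : ∀ v, L v 1 = b₁ * dLogRadius x v + b₂ * dAngle x v) :
    ‖L‖ ≤ (|a₁| + |a₂| + |b₁| + |b₂|) * ‖x‖⁻¹ := by
  refine ContinuousLinearMap.opNorm_le_bound _ (by positivity) fun v => ?_
  have ht := abs_dLogRadius_le x v
  have hθ := abs_dAngle_le x v
  have comb : ∀ a b : ℝ, |a * dLogRadius x v + b * dAngle x v| ≤
      (|a| + |b|) * (‖x‖⁻¹ * ‖v‖) := fun a b => by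
    refine (abs_add_le _ _).trans ?_
    rw [abs_mul, abs_mul, add_mul]
    gcongr
  refine (EuclideanSpace.norm_fin_two_le _).trans ?_
  rw [h0, h1]
  linarith [comb a₁ a₂, comb b₁ b₂]

/-! ### The profile functions -/

/-- The amplitude `g` of the oscillation, as a function of the logarithmic radius `t`. -/
noncomputable def amp (a t : ℝ) : ℝ := Real.exp (a * (Real.log t - t)) / t

/-- The phase `A` of the spiral, normalised by `A' = 1 / (t g)`; with this choice the radial
derivatives of `log t` and of `g P` cancel where the slope of the triangle wave is `-1`. -/
noncomputable def phase (a t : ℝ) : ℝ := ∫ τ in (1 : ℝ)..t, Real.exp (a * (τ - Real.log τ))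

/-- The amplitude `g² t` of the vertical oscillation, of the order of the width of the
image strip. -/
noncomputable def width (a t : ℝ) : ℝ := amp a t * amp a t * t

theorem amp_pos (a : ℝ) {t : ℝ} (ht : 0 < t) : 0 < amp a t := div_pos (Real.exp_pos _) ht

theorem hasStrictDerivAt_amp (a : ℝ) {t : ℝ} (ht : 0 < t) :
    HasStrictDerivAt (amp a) (amp a t * (a * (t⁻¹ - 1) - t⁻¹)) t := by
  have h1 := ((((Real.hasStrictDerivAt_log ht.ne').sub (hasStrictDerivAt_id t)).const_mul a).exp).div
    (hasStrictDerivAt_id t) ht.ne'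
  refine h1.congr_deriv ?_
  simp only [amp, id, Pi.sub_apply]
  field_simp

theorem hasStrictDerivAt_width (a : ℝ) {t : ℝ} (ht : 0 < t) :
    HasStrictDerivAt (width a) (width a t * (2 * (a * (t⁻¹ - 1) - t⁻¹) + t⁻¹)) t := by
  have hg := hasStrictDerivAt_amp a ht
  have h1 := (hg.mul hg).mul (hasStrictDerivAt_id t)
  refine h1.congr_deriv ?_
  simp only [width, id, Pi.mul_apply]
  field_simp
  ring

theorem hasStrictDerivAt_phase (a : ℝ) {t : ℝ} (ht : 0 < t) :
    HasStrictDerivAt (phase a) ((amp a t * t)⁻¹) t := by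
  have hc : ContinuousOn (fun τ : ℝ => Real.exp (a * (τ - Real.log τ))) (Set.Ioi 0) := by
    refine Real.continuous_exp.comp_continuousOn (continuousOn_const.mul
      (continuousOn_id.sub (Real.continuousOn_log.mono fun y hy => ?_)))
    exact (Set.mem_Ioi.1 hy).ne'
  have h := intervalIntegral.integral_hasStrictDerivAt_right (a := 1) (b := t)
    (hc.mono ?_).intervalIntegrable
    (hc.stronglyMeasurableAtFilter isOpen_Ioi t ht) (hc.continuousAt (Ioi_mem_nhds ht))
  · refine h.congr_deriv ?_
    rw [amp, div_mul_cancel₀ _ ht.ne', ← Real.exp_neg]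
    congr 1; ring
  · intro y hy
    rw [Set.mem_uIcc] at hy
    rcases hy with hy | hy <;> simp only [Set.mem_Ioi] <;> linarith

/-! ### The spiral phase and its triangle wave -/

/-- `sin φ`, where `φ` is the sum of `phase` and the polar angle. -/
noncomputable def sinPhase (a : ℝ) (x : EuclideanSpace ℝ (Fin 2)) : ℝ :=
  Real.cos (phase a (logRadius x)) * (x 1 * Real.exp (logRadius x)) +
    Real.sin (phase a (logRadius x)) * (x 0 * Real.exp (logRadius x))

/-- `cos φ`, where `φ` is the sum of `phase` and the polar angle. -/
noncomputable def cosPhase (a : ℝ) (x : EuclideanSpace ℝ (Fin 2)) : ℝ :=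
  Real.cos (phase a (logRadius x)) * (x 0 * Real.exp (logRadius x)) -
    Real.sin (phase a (logRadius x)) * (x 1 * Real.exp (logRadius x))

/-- The triangle wave `arcsin (sin φ)` of the spiral phase. -/
noncomputable def spiralWave (a : ℝ) (x : EuclideanSpace ℝ (Fin 2)) : ℝ :=
  Real.arcsin (sinPhase a x)

/-- The differential of the spiral phase. -/
noncomputable def dPhase (a : ℝ) (x : EuclideanSpace ℝ (Fin 2)) :
    EuclideanSpace ℝ (Fin 2) →L[ℝ] ℝ :=
  (amp a (logRadius x) * logRadius x)⁻¹ • dLogRadius x + dAngle x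

theorem cosPhase_sq_add_sinPhase_sq (a : ℝ) {x : EuclideanSpace ℝ (Fin 2)} (hx : x ≠ 0) :
    cosPhase a x ^ 2 + sinPhase a x ^ 2 = 1 := by
  have h1 := Real.sin_sq_add_cos_sq (phase a (logRadius x))
  have h2 : (x 0 ^ 2 + x 1 ^ 2) * Real.exp (logRadius x) ^ 2 = 1 := by
    rw [← norm_sq_fin_two, exp_logRadius hx, ← mul_pow,
      mul_inv_cancel₀ (norm_ne_zero_iff.2 hx), one_pow]
  simp only [cosPhase, sinPhase]
  linear_combination (x 0 ^ 2 + x 1 ^ 2) * Real.exp (logRadius x) ^ 2 * h1 + h2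

/-- The derivatives of `cos θ = x₀ / |x|` and `sin θ = x₁ / |x|`, with `1 / |x|` written `exp t`. -/
theorem hasStrictFDerivAt_coord_mul_exp {x : EuclideanSpace ℝ (Fin 2)} (hx : x ≠ 0) :
    HasStrictFDerivAt (fun y : EuclideanSpace ℝ (Fin 2) => y 0 * Real.exp (logRadius y))
      (-(x 1 * Real.exp (logRadius x)) • dAngle x) x ∧
    HasStrictFDerivAt (fun y : EuclideanSpace ℝ (Fin 2) => y 1 * Real.exp (logRadius y))
      ((x 0 * Real.exp (logRadius x)) • dAngle x) x := by
  have he := (hasStrictFDerivAt_logRadius hx).exp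
  have hp : ∀ i : Fin 2, HasStrictFDerivAt (fun y : EuclideanSpace ℝ (Fin 2) => y i)
      (EuclideanSpace.proj i : EuclideanSpace ℝ (Fin 2) →L[ℝ] ℝ) x := fun i =>
    (EuclideanSpace.proj i : EuclideanSpace ℝ (Fin 2) →L[ℝ] ℝ).hasStrictFDerivAt
  have hn : ‖x‖ ≠ 0 := norm_ne_zero_iff.2 hx
  have h2 := norm_sq_fin_two x
  constructor
  · refine ((hp 0).mul he).congr_fderiv (ContinuousLinearMap.ext fun v => ?_)
    simp [dLogRadius, dAngle]
    field_simp
    rw [h2]; ring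
  · refine ((hp 1).mul he).congr_fderiv (ContinuousLinearMap.ext fun v => ?_)
    simp [dLogRadius, dAngle]
    field_simp
    rw [h2]; ring

theorem hasStrictFDerivAt_comp_logRadius {F : ℝ → ℝ} {F' : ℝ} {x : EuclideanSpace ℝ (Fin 2)}
    (hx : x ≠ 0) (hF : HasStrictDerivAt F F' (logRadius x)) :
    HasStrictFDerivAt (fun y => F (logRadius y)) (F' • dLogRadius x) x :=
  hF.comp_hasStrictFDerivAt x (hasStrictFDerivAt_logRadius hx)

theorem hasStrictFDerivAt_sinPhase (a : ℝ) {x : EuclideanSpace ℝ (Fin 2)} (hx : x ≠ 0)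
    (ht : 0 < logRadius x) : HasStrictFDerivAt (sinPhase a) (cosPhase a x • dPhase a x) x := by
  have hA := hasStrictFDerivAt_comp_logRadius hx (hasStrictDerivAt_phase a ht)
  obtain ⟨h0, h1⟩ := hasStrictFDerivAt_coord_mul_exp hx
  refine ((hA.cos.mul h1).add (hA.sin.mul h0)).congr_fderiv
    (ContinuousLinearMap.ext fun v => ?_)
  simp [cosPhase, dPhase]
  ring

theorem hasStrictFDerivAt_cosPhase (a : ℝ) {x : EuclideanSpace ℝ (Fin 2)} (hx : x ≠ 0)
    (ht : 0 < logRadius x) : HasStrictFDerivAt (cosPhase a) (-sinPhase a x • dPhase a x) x := by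
  have hA := hasStrictFDerivAt_comp_logRadius hx (hasStrictDerivAt_phase a ht)
  obtain ⟨h0, h1⟩ := hasStrictFDerivAt_coord_mul_exp hx
  refine ((hA.cos.mul h0).sub (hA.sin.mul h1)).congr_fderiv
    (ContinuousLinearMap.ext fun v => ?_)
  simp [sinPhase, dPhase]
  ring

theorem abs_spiralWave_le (a : ℝ) (x : EuclideanSpace ℝ (Fin 2)) : |spiralWave a x| ≤ 2 := by
  have h1 := Real.neg_pi_div_two_le_arcsin (sinPhase a x)
  have h2 := Real.arcsin_le_pi_div_two (sinPhase a x)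
  have h3 := Real.pi_le_four
  rw [spiralWave, abs_le]
  constructor <;> linarith

theorem hasFDerivAt_spiralWave (a : ℝ) {x : EuclideanSpace ℝ (Fin 2)} (hx : x ≠ 0)
    (ht : 0 < logRadius x) (hc : cosPhase a x ≠ 0) :
    HasFDerivAt (spiralWave a) ((cosPhase a x / |cosPhase a x|) • dPhase a x) x := by
  have h1 := cosPhase_sq_add_sinPhase_sq a hx
  have hpos : 0 < cosPhase a x ^ 2 := by positivity
  have h := (Real.hasDerivAt_arcsin (x := sinPhase a x) (by intro h; rw [h] at h1; linarith)
    (by intro h; rw [h] at h1; linarith)).comp_hasFDerivAt x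
      (hasStrictFDerivAt_sinPhase a hx ht).hasFDerivAt
  refine h.congr_fderiv ?_
  rw [smul_smul, ← Real.sqrt_sq_eq_abs, show 1 - sinPhase a x ^ 2 = cosPhase a x ^ 2 by linarith]
  congr 1
  ring

theorem isOpen_unitBall_diff_zero : IsOpen (Metric.ball (0 : EuclideanSpace ℝ (Fin 2)) 1 \ {0}) :=
  Metric.isOpen_ball.sdiff isClosed_singleton

theorem logRadius_pos {x : EuclideanSpace ℝ (Fin 2)}
    (hx : x ∈ Metric.ball (0 : EuclideanSpace ℝ (Fin 2)) 1 \ {0}) : 0 < logRadius x := by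
  have h0 : 0 < ‖x‖ := norm_pos_iff.2 hx.2
  have h1 := mem_ball_zero_iff.1 hx.1
  rw [logRadius, neg_pos]
  exact Real.log_neg h0 h1

theorem locallyLipschitzOn_spiralWave (a : ℝ) :
    LocallyLipschitzOn (Metric.ball (0 : EuclideanSpace ℝ (Fin 2)) 1 \ {0}) (spiralWave a) := by
  intro x hx
  obtain ⟨K₁, t₁, ht₁, h₁⟩ :=
    (hasStrictFDerivAt_sinPhase a hx.2 (logRadius_pos hx)).exists_lipschitzOnWith
  obtain ⟨K₂, t₂, ht₂, h₂⟩ :=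
    (hasStrictFDerivAt_cosPhase a hx.2 (logRadius_pos hx)).exists_lipschitzOnWith
  refine ⟨Real.toNNReal (Real.pi / 2) * (K₁ + K₂), t₁ ∩ t₂ ∩ (Metric.ball 0 1 \ {0}), ?_, ?_⟩
  · exact inter_mem (mem_nhdsWithin_of_mem_nhds (inter_mem ht₁ ht₂)) self_mem_nhdsWithin
  · refine LipschitzOnWith.of_dist_le_mul fun y hy z hz => ?_
    have e := abs_arcsin_sub_arcsin_le (cosPhase_sq_add_sinPhase_sq a hy.2.2)
      (cosPhase_sq_add_sinPhase_sq a hz.2.2)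
    have e₁ := h₁.dist_le_mul y hy.1.1 z hz.1.1
    have e₂ := h₂.dist_le_mul y hy.1.2 z hz.1.2
    rw [Real.dist_eq] at e₁ e₂ ⊢
    have hpi := Real.pi_pos
    push_cast
    rw [Real.coe_toNNReal _ (by positivity), mul_assoc]
    refine e.trans (mul_le_mul_of_nonneg_left ?_ (by positivity))
    linarith

/-- The ridges of the triangle wave form a null set: at a point of differentiability on a ridge,
the wave has an extremum, so that `|cos φ| = cos (arcsin (sin φ))` has zero derivative there,
whereas `cos φ` does not. -/
theorem ae_cosPhase_ne_zero (a : ℝ) :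
    ∀ᵐ x, x ∈ Metric.ball (0 : EuclideanSpace ℝ (Fin 2)) 1 \ {0} → cosPhase a x ≠ 0 := by
  filter_upwards [(locallyLipschitzOn_spiralWave a).ae_differentiableAt isOpen_unitBall_diff_zero]
    with x hx hxO hc
  have hd := (hx hxO).hasFDerivAt
  have ht := logRadius_pos hxO
  have h1 := cosPhase_sq_add_sinPhase_sq a hxO.2
  have hs : sinPhase a x = 1 ∨ sinPhase a x = -1 := by
    rw [hc] at h1
    exact sq_eq_sq_iff_eq_or_eq_neg.1 (by linarith)
  have hD : HasFDerivAt (spiralWave a) (0 : EuclideanSpace ℝ (Fin 2) →L[ℝ] ℝ) x := by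
    have : IsLocalExtr (spiralWave a) x := by
      rcases hs with hs | hs
      · right
        refine Eventually.of_forall fun y => ?_
        simp only [spiralWave]
        rw [hs, Real.arcsin_one]
        exact Real.arcsin_le_pi_div_two _
      · left
        refine Eventually.of_forall fun y => ?_
        simp only [spiralWave]
        rw [hs, Real.arcsin_neg_one]
        exact Real.neg_pi_div_two_le_arcsin _
    rw [this.fderiv_eq_zero] at hd
    exact hd
  have habs : HasFDerivAt (fun y => |cosPhase a y|) (0 : EuclideanSpace ℝ (Fin 2) →L[ℝ] ℝ) x := by
    have h2 := hD.cos
    rw [smul_zero] at h2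
    refine h2.congr_of_eventuallyEq ?_
    filter_upwards [isOpen_unitBall_diff_zero.mem_nhds hxO] with y hy
    rw [spiralWave, Real.cos_arcsin, ← Real.sqrt_sq_eq_abs]
    congr 1
    have := cosPhase_sq_add_sinPhase_sq a hy.2
    linarith
  have hzero : HasFDerivAt (cosPhase a) (0 : EuclideanSpace ℝ (Fin 2) →L[ℝ] ℝ) x := by
    rw [hasFDerivAt_iff_isLittleO] at habs ⊢
    simp only [hc, abs_zero, sub_zero, zero_apply] at habs ⊢
    exact Asymptotics.isLittleO_abs_left.1 habs
  have heq := (hasStrictFDerivAt_cosPhase a hxO.2 ht).hasFDerivAt.unique hzero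
  have hne : sinPhase a x ≠ 0 := by rcases hs with hs | hs <;> rw [hs] <;> norm_num
  have hph : dPhase a x = 0 := by
    rcases smul_eq_zero.1 heq with h | h
    · exact absurd (neg_eq_zero.1 h) hne
    · exact h
  -- evaluate on the tangential vector
  have hv := congrArg (fun L : EuclideanSpace ℝ (Fin 2) →L[ℝ] ℝ => L !₂[-x 1, x 0]) hph
  have hn : ‖x‖ ≠ 0 := norm_ne_zero_iff.2 hxO.2
  have h2 := norm_sq_fin_two x
  simp [dPhase, dLogRadius, dAngle] at hv
  field_simp at hv
  have : logRadius x * ‖x‖ ^ 2 = 0 := by rw [h2]; linear_combination hv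
  exact mul_ne_zero ht.ne' (pow_ne_zero 2 hn) this

/-! ### The map and its pointwise distortion -/

/-- The horizontal component `log t + g P` of the map. -/
noncomputable def spiralFst (a : ℝ) (x : EuclideanSpace ℝ (Fin 2)) : ℝ :=
  Real.log (logRadius x) + amp a (logRadius x) * spiralWave a x

/-- The vertical component `-g² t P` of the map. -/
noncomputable def spiralSnd (a : ℝ) (x : EuclideanSpace ℝ (Fin 2)) : ℝ :=
  -(width a (logRadius x) * spiralWave a x)

/-- The map which folds a neighbourhood of the origin along a spiral into a strip of infinite
length and finite area. -/
noncomputable def spiralMap (a : ℝ) (x : EuclideanSpace ℝ (Fin 2)) : EuclideanSpace ℝ (Fin 2) :=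
  !₂[spiralFst a x, spiralSnd a x]

theorem hasFDerivAt_spiralFst (a : ℝ) {x : EuclideanSpace ℝ (Fin 2)} (hx : x ≠ 0)
    (ht : 0 < logRadius x) (hc : cosPhase a x ≠ 0) :
    HasFDerivAt (spiralFst a)
      (((logRadius x)⁻¹ + amp a (logRadius x) * (a * ((logRadius x)⁻¹ - 1) - (logRadius x)⁻¹) *
          spiralWave a x + cosPhase a x / |cosPhase a x| * (logRadius x)⁻¹) • dLogRadius x +
        (cosPhase a x / |cosPhase a x| * amp a (logRadius x)) • dAngle x) x := by
  have h1 := (hasStrictFDerivAt_comp_logRadius hx (Real.hasStrictDerivAt_log ht.ne')).hasFDerivAt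
  have h2 := (hasStrictFDerivAt_comp_logRadius hx (hasStrictDerivAt_amp a ht)).hasFDerivAt
  have h3 := hasFDerivAt_spiralWave a hx ht hc
  refine (h1.add (h2.mul h3)).congr_fderiv (ContinuousLinearMap.ext fun v => ?_)
  have hg := (amp_pos a ht).ne'
  have ht' := ht.ne'
  simp [dPhase]
  field_simp
  ring

theorem hasFDerivAt_spiralSnd (a : ℝ) {x : EuclideanSpace ℝ (Fin 2)} (hx : x ≠ 0)
    (ht : 0 < logRadius x) (hc : cosPhase a x ≠ 0) :
    HasFDerivAt (spiralSnd a)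
      ((-(width a (logRadius x) * (2 * (a * ((logRadius x)⁻¹ - 1) - (logRadius x)⁻¹) +
          (logRadius x)⁻¹) * spiralWave a x + cosPhase a x / |cosPhase a x| * amp a (logRadius x)))
          • dLogRadius x +
        (-(cosPhase a x / |cosPhase a x| * width a (logRadius x))) • dAngle x) x := by
  have h2 := (hasStrictFDerivAt_comp_logRadius hx (hasStrictDerivAt_width a ht)).hasFDerivAt
  have h3 := hasFDerivAt_spiralWave a hx ht hc
  refine (h2.mul h3).neg.congr_fderiv (ContinuousLinearMap.ext fun v => ?_)
  have hg := (amp_pos a ht).ne'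
  have ht' := ht.ne'
  simp [dPhase, width]
  field_simp
  ring

/-- The rows of the derivative of the map are the derivatives of its components. -/
theorem fderiv_spiralMap_apply {a : ℝ} {x : EuclideanSpace ℝ (Fin 2)}
    {L₀ L₁ : EuclideanSpace ℝ (Fin 2) →L[ℝ] ℝ} (h0 : HasFDerivAt (spiralFst a) L₀ x)
    (h1 : HasFDerivAt (spiralSnd a) L₁ x) :
    (∀ v, fderiv ℝ (spiralMap a) x v 0 = L₀ v) ∧ (∀ v, fderiv ℝ (spiralMap a) x v 1 = L₁ v) := by
  have hd : DifferentiableAt ℝ (spiralMap a) x := by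
    rw [differentiableAt_euclidean]
    intro i
    fin_cases i
    · exact h0.differentiableAt
    · exact h1.differentiableAt
  have hc : ∀ i : Fin 2, HasFDerivAt (fun y => spiralMap a y i)
      ((EuclideanSpace.proj i : EuclideanSpace ℝ (Fin 2) →L[ℝ] ℝ).comp
        (fderiv ℝ (spiralMap a) x)) x := fun i =>
    (EuclideanSpace.proj i : EuclideanSpace ℝ (Fin 2) →L[ℝ] ℝ).hasFDerivAt.comp x hd.hasFDerivAt
  have e0 := (hc 0).unique (show HasFDerivAt (fun y => spiralMap a y 0) L₀ x from h0)
  have e1 := (hc 1).unique (show HasFDerivAt (fun y => spiralMap a y 1) L₁ x from h1)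
  exact ⟨fun v => by rw [← e0]; rfl, fun v => by rw [← e1]; rfl⟩

theorem log_le_half {t : ℝ} (ht : 0 < t) : Real.log t ≤ t / 2 := by
  have h1 := Real.log_le_sub_one_of_pos (show 0 < t / 2 by positivity)
  have h2 : Real.log t = Real.log (t / 2) + Real.log 2 := by
    rw [← Real.log_mul (by positivity) (by norm_num)]; congr 1; ring
  have h3 := Real.log_le_sub_one_of_pos (show (0 : ℝ) < 2 by norm_num)
  linarith

theorem amp_mul_self_le {a t : ℝ} (ha : 1 / 2 ≤ a) (ht : 16 ≤ t) : amp a t * t ≤ 1 / 16 := by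
  have ht0 : 0 < t := by linarith
  rw [amp, div_mul_cancel₀ _ ht0.ne']
  have h1 := log_le_half ht0
  have h2 : a * (Real.log t - t) ≤ -4 := by nlinarith
  have h3 : (2 : ℝ) ≤ Real.exp 1 := by have := Real.add_one_le_exp 1; linarith
  have h4 : (16 : ℝ) ≤ Real.exp 4 := by
    have : Real.exp 4 = Real.exp 1 ^ 4 := by rw [← Real.exp_nat_mul]; norm_num
    rw [this]
    calc (16 : ℝ) = 2 ^ 4 := by norm_num
      _ ≤ _ := pow_le_pow_left₀ (by norm_num) h3 4
  calc Real.exp (a * (Real.log t - t)) ≤ Real.exp (-4) := Real.exp_le_exp.2 h2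
    _ = (Real.exp 4)⁻¹ := Real.exp_neg 4
    _ ≤ _ := by rw [one_div]; exact inv_anti₀ (by norm_num) h4

/-- The real inequalities behind the distortion estimate, for the coefficients of the two rows of
the derivative in the frame `dLogRadius`, `dAngle`. Here `d` stands for `g' / g`; the map is slow
where `σ = -1`, and orientation preserving where `σ = 1`. -/
theorem spiral_coefficient_bounds {t g d P σ : ℝ} (ht : 16 ≤ t) (hg : 0 < g)
    (hgt : g * t ≤ 1 / 16) (hd : |d| ≤ 1) (hP : |P| ≤ 2) (hσ : σ = 1 ∨ σ = -1) :
    (|t⁻¹ + g * d * P + σ * t⁻¹| + |σ * g| + |-(g * g * t * (2 * d + t⁻¹) * P + σ * g)| +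
        |-(σ * (g * g * t))| ≤ 6 * t⁻¹) ∧
      (σ = -1 → |t⁻¹ + g * d * P + σ * t⁻¹| + |σ * g| +
        |-(g * g * t * (2 * d + t⁻¹) * P + σ * g)| + |-(σ * (g * g * t))| ≤ 6 * g) ∧
      (σ = 1 → g ^ 2 / 2 ≤ σ * g * -(g * g * t * (2 * d + t⁻¹) * P + σ * g) -
        (t⁻¹ + g * d * P + σ * t⁻¹) * -(σ * (g * g * t))) := by
  have ht0 : 0 < t := by linarith
  have hti : 0 < t⁻¹ := inv_pos.2 ht0
  have hti1 : t⁻¹ ≤ 1 := inv_le_one_of_one_le₀ (by linarith)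
  have hgti : g ≤ t⁻¹ / 16 := by
    calc g = g * t * t⁻¹ := by field_simp
      _ ≤ 1 / 16 * t⁻¹ := mul_le_mul_of_nonneg_right hgt hti.le
      _ = t⁻¹ / 16 := by ring
  have hdP : |d * P| ≤ 2 := by
    rw [abs_mul]; nlinarith [abs_nonneg d, abs_nonneg P]
  have hσ1 : |σ| = 1 := by rcases hσ with rfl | rfl <;> norm_num
  have hgdP : |g * d * P| ≤ 2 * g := by
    rw [mul_assoc, abs_mul, abs_of_pos hg]; nlinarith
  have hggt : 0 < g * g * t := by positivity
  have hggt' : g * g * t ≤ g / 16 := by nlinarith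
  have h3 : |(2 * d + t⁻¹) * P| ≤ 6 := by
    have : |2 * d + t⁻¹| ≤ 3 := by
      rw [abs_le] at hd ⊢; constructor <;> linarith
    rw [abs_mul]; nlinarith [abs_nonneg (2 * d + t⁻¹), abs_nonneg P]
  have h4 : |g * g * t * (2 * d + t⁻¹) * P| ≤ 6 * (g / 16) := by
    rw [mul_assoc, abs_mul, abs_of_pos hggt]; nlinarith [abs_nonneg ((2 * d + t⁻¹) * P)]
  have e2 : |σ * g| = g := by rw [abs_mul, hσ1, one_mul, abs_of_pos hg]
  have e4 : |-(σ * (g * g * t))| = g * g * t := by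
    rw [abs_neg, abs_mul, hσ1, one_mul, abs_of_pos hggt]
  have e3 : |-(g * g * t * (2 * d + t⁻¹) * P + σ * g)| ≤ 6 * (g / 16) + g := by
    rw [abs_neg]; exact (abs_add_le _ _).trans (by rw [e2]; linarith)
  rw [e2, e4]
  refine ⟨?_, ?_, ?_⟩
  · have e1 : |t⁻¹ + g * d * P + σ * t⁻¹| ≤ 2 * t⁻¹ + 2 * g := by
      have hs : |σ * t⁻¹| = t⁻¹ := by rw [abs_mul, hσ1, one_mul, abs_of_pos hti]
      refine (abs_add_le _ _).trans ?_
      rw [hs]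
      have := abs_add_le t⁻¹ (g * d * P)
      rw [abs_of_pos hti] at this
      linarith
    linarith
  · rintro rfl
    rw [show t⁻¹ + g * d * P + -1 * t⁻¹ = g * d * P by ring]
    linarith
  · rintro rfl
    have e : 1 * g * -(g * g * t * (2 * d + t⁻¹) * P + 1 * g) -
        (t⁻¹ + g * d * P + 1 * t⁻¹) * -(1 * (g * g * t)) =
        g ^ 2 - g ^ 2 * ((g * t) * ((d + t⁻¹) * P)) := by
      field_simp; ring
    rw [e]
    have h5 : |(d + t⁻¹) * P| ≤ 4 := by
      have : |d + t⁻¹| ≤ 2 := by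
        rw [abs_le] at hd ⊢; constructor <;> linarith
      rw [abs_mul]; nlinarith [abs_nonneg (d + t⁻¹), abs_nonneg P]
    have h6 : (g * t) * ((d + t⁻¹) * P) ≤ 1 / 2 := by
      have := (abs_le.1 h5).2
      have hgt0 : 0 < g * t := by positivity
      nlinarith
    nlinarith [sq_nonneg g]

/-- Off the ridges, either the derivative is small or the Jacobian determinant is bounded below. -/
theorem spiralMap_distortion {a : ℝ} (ha : 1 / 2 ≤ a) (ha' : a ≤ 1)
    {x : EuclideanSpace ℝ (Fin 2)} (hx : x ≠ 0) (ht : 16 ≤ logRadius x)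
    (hc : cosPhase a x ≠ 0) :
    ‖fderiv ℝ (spiralMap a) x‖ ≤ 6 * (logRadius x)⁻¹ * ‖x‖⁻¹ ∧
    (‖fderiv ℝ (spiralMap a) x‖ ≤ 6 * amp a (logRadius x) * ‖x‖⁻¹ ∨
      amp a (logRadius x) ^ 2 / 2 * ‖x‖⁻¹ ^ 2 ≤ (fderiv ℝ (spiralMap a) x).det) := by
  have ht0 : 0 < logRadius x := by linarith
  obtain ⟨h0, h1⟩ := fderiv_spiralMap_apply
    (hasFDerivAt_spiralFst a hx ht0 hc) (hasFDerivAt_spiralSnd a hx ht0 hc)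
  simp only [add_apply, smul_apply, smul_eq_mul] at h0 h1
  have hσ : cosPhase a x / |cosPhase a x| = 1 ∨ cosPhase a x / |cosPhase a x| = -1 := by
    rcases lt_or_gt_of_ne hc with h | h
    · right; rw [abs_of_neg h, div_neg, div_self hc]
    · left; rw [abs_of_pos h, div_self hc]
  have hd : |a * ((logRadius x)⁻¹ - 1) - (logRadius x)⁻¹| ≤ 1 := by
    have hti : 0 < (logRadius x)⁻¹ := inv_pos.2 ht0
    have hti1 : (logRadius x)⁻¹ ≤ 1 := inv_le_one_of_one_le₀ (by linarith)
    rw [abs_le]; constructor <;> nlinarith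
  obtain ⟨b1, b2, b3⟩ := spiral_coefficient_bounds ht (amp_pos a ht0) (amp_mul_self_le ha ht) hd
    (abs_spiralWave_le a x) hσ
  have hn := norm_le_of_logPolar h0 h1
  have hdet := det_of_logPolar hx h0 h1
  have hxi : 0 ≤ ‖x‖⁻¹ := inv_nonneg.2 (norm_nonneg x)
  refine ⟨hn.trans (mul_le_mul_of_nonneg_right b1 hxi), ?_⟩
  rcases hσ with h | h
  · right
    rw [hdet]
    exact mul_le_mul_of_nonneg_right (b3 h) (by positivity)
  · left
    exact hn.trans (mul_le_mul_of_nonneg_right (b2 h) hxi)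

/-- The map grows like `log log (1 / |x|)`; the upper bound is crude but sufficient. -/
theorem norm_spiralMap_le {a : ℝ} (ha : 1 / 2 ≤ a) {x : EuclideanSpace ℝ (Fin 2)}
    (ht : 16 ≤ logRadius x) :
    ‖spiralMap a x‖ ≤ logRadius x ∧ Real.log (logRadius x) - 1 ≤ ‖spiralMap a x‖ := by
  have ht0 : 0 < logRadius x := by linarith
  have hgt := amp_mul_self_le ha ht
  have hg := amp_pos a ht0
  have hg1 : amp a (logRadius x) ≤ 1 / 16 := by nlinarith
  have hP := abs_spiralWave_le a x
  have hl := log_le_half ht0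
  have hl0 : 0 ≤ Real.log (logRadius x) := Real.log_nonneg (by linarith)
  have h1 : |amp a (logRadius x) * spiralWave a x| ≤ 1 / 8 := by
    rw [abs_mul, abs_of_pos hg]; nlinarith [abs_nonneg (spiralWave a x)]
  have hw : 0 < width a (logRadius x) := by unfold width; positivity
  have hw1 : width a (logRadius x) ≤ 1 / 16 := by unfold width; nlinarith
  have h2 : |spiralSnd a x| ≤ 1 / 8 := by
    rw [spiralSnd, abs_neg, abs_mul, abs_of_pos hw]; nlinarith [abs_nonneg (spiralWave a x)]
  constructor
  · refine (EuclideanSpace.norm_fin_two_le _).trans ?_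
    change |spiralFst a x| + |spiralSnd a x| ≤ _
    have h3 : |spiralFst a x| ≤ Real.log (logRadius x) + 1 / 8 := by
      refine (abs_add_le _ _).trans ?_
      rw [abs_of_nonneg hl0]; linarith
    linarith
  · have h3 : |spiralFst a x| ≤ ‖spiralMap a x‖ := PiLp.norm_apply_le (spiralMap a x) 0
    have h4 := le_abs_self (spiralFst a x)
    have h5 := (abs_le.1 h1).1
    have h6 : spiralFst a x = Real.log (logRadius x) + amp a (logRadius x) * spiralWave a x := rfl
    linarith

theorem tendsto_logRadius :
    Tendsto logRadius (𝓝[≠] (0 : EuclideanSpace ℝ (Fin 2))) atTop := by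
  refine tendsto_neg_atBot_atTop.comp (Real.tendsto_log_nhdsGT_zero.comp ?_)
  exact tendsto_norm_nhdsNE_zero

theorem tendsto_norm_spiralMap {a : ℝ} (ha : 1 / 2 ≤ a) :
    Tendsto (fun x => ‖spiralMap a x‖) (𝓝[≠] (0 : EuclideanSpace ℝ (Fin 2))) atTop := by
  have h := tendsto_atTop_add_const_right _ (-1 : ℝ) (Real.tendsto_log_atTop.comp tendsto_logRadius)
  refine tendsto_atTop_mono' _ ?_ h
  filter_upwards [tendsto_logRadius.eventually_ge_atTop 16] with x hx
  exact (norm_spiralMap_le ha hx).2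

/-! ### The integrable weight -/

/-- The critically integrable weight `J = (|x| log (1 / |x|))⁻²`. -/
noncomputable def logWeight (x : EuclideanSpace ℝ (Fin 2)) : ℝ :=
  (‖x‖⁻¹ * (logRadius x)⁻¹) ^ 2

theorem measurable_logRadius : Measurable logRadius :=
  (Real.measurable_log.comp measurable_norm).neg

theorem measurable_logWeight : Measurable logWeight :=
  (measurable_norm.inv.mul measurable_logRadius.inv).pow_const 2

theorem logWeight_nonneg (x : EuclideanSpace ℝ (Fin 2)) : 0 ≤ logWeight x := sq_nonneg _

theorem integrableOn_logWeight {r : ℝ} (hr1 : r < 1) :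
    IntegrableOn logWeight (Metric.ball 0 r) := by
  refine (integrableOn_fun_norm_addHaar volume
    (f := fun y : ℝ => (y⁻¹ * (-Real.log y)⁻¹) ^ 2)).2 ?_
  -- `y J(y)` is the derivative of `-1 / log y`, which extends continuously by `0` to `y = 0`
  have hlog : ∀ y ∈ Set.Ioo 0 r, Real.log y ≠ 0 := fun y hy =>
    (Real.log_neg hy.1 (hy.2.trans hr1)).ne
  have hcont : ContinuousOn (fun y : ℝ => -(Real.log y)⁻¹) (Set.Icc 0 r) := by
    intro y hy
    rcases hy.1.eq_or_lt with rfl | hy0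
    · have h0 : Tendsto (fun y : ℝ => -(Real.log y)⁻¹) (𝓝[>] 0) (𝓝 (-(Real.log 0)⁻¹)) := by
        have := (tendsto_inv_atBot_zero.comp Real.tendsto_log_nhdsGT_zero).neg
        simpa using this
      refine ContinuousWithinAt.mono ?_ Set.Icc_subset_Ici_self
      rw [← continuousWithinAt_Ioi_iff_Ici]
      exact h0
    · have : Real.log y ≠ 0 := (Real.log_neg hy0 (hy.2.trans_lt hr1)).ne
      exact ((Real.continuousAt_log hy0.ne').inv₀ this).neg.continuousWithinAt
  have h := intervalIntegral.integrableOn_deriv_of_nonneg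
    (g' := fun y => y ^ (Module.finrank ℝ (EuclideanSpace ℝ (Fin 2)) - 1) •
      (y⁻¹ * (-Real.log y)⁻¹) ^ 2) hcont (fun y hy => ?_) (fun y hy => ?_)
  · exact h.mono_set Set.Ioo_subset_Ioc_self
  · have := ((Real.hasDerivAt_log hy.1.ne').inv (hlog y hy)).neg
    refine this.congr_deriv ?_
    have h0 := hy.1.ne'
    have h1 := hlog y hy
    simp
    field_simp
  · have := hy.1
    positivity

theorem logWeight_rpow {x : EuclideanSpace ℝ (Fin 2)} (hx : x ≠ 0) (ht : 0 < logRadius x) (c : ℝ) :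
    logWeight x ^ c = Real.exp (2 * c * (logRadius x - Real.log (logRadius x))) := by
  have h : logWeight x = Real.exp (2 * (logRadius x - Real.log (logRadius x))) := by
    rw [logWeight, ← exp_logRadius hx, mul_comm 2, Real.exp_mul, Real.exp_sub, Real.exp_log ht,
      div_eq_mul_inv, Real.rpow_two]
  rw [h, ← Real.exp_mul]
  congr 1; ring

/-- The size `(g / |x|)²` of the squared derivative where the map is slow, in terms of
the weight. -/
theorem amp_sq_mul {a : ℝ} {x : EuclideanSpace ℝ (Fin 2)} (hx : x ≠ 0) (ht : 0 < logRadius x) :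
    amp a (logRadius x) ^ 2 * ‖x‖⁻¹ ^ 2 = logWeight x ^ (1 - a) := by
  have h1 := logWeight_rpow hx ht 1
  rw [Real.rpow_one] at h1
  have h2 : logWeight x ^ (1 - a) = Real.exp (a * (Real.log (logRadius x) - logRadius x)) ^ 2 *
      logWeight x := by
    rw [logWeight_rpow hx ht, h1, ← Real.exp_nat_mul, ← Real.exp_add]
    congr 1; push_cast; ring
  rw [h2, amp, logWeight]
  field_simp

/-- With the crude bound `|f| ≤ t`, these give `|f|² ≲ J` and `|f| / |x| ≲ J`. -/
theorem logWeight_bounds {x : EuclideanSpace ℝ (Fin 2)} (hx : x ≠ 0) (ht : 16 ≤ logRadius x) :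
    logRadius x ^ 2 ≤ 24 * logWeight x ∧ ‖x‖⁻¹ * logRadius x ≤ 6 * logWeight x := by
  have ht0 : 0 < logRadius x := by linarith
  have h3 := Real.pow_div_factorial_le_exp (logRadius x) ht0.le 3
  have h4 := Real.pow_div_factorial_le_exp (logRadius x) ht0.le 4
  have h1 : 1 ≤ Real.exp (logRadius x) := Real.one_le_exp ht0.le
  rw [logWeight, ← exp_logRadius hx]
  set t := logRadius x
  set e := Real.exp t
  norm_num [Nat.factorial] at h3 h4
  have e1 : 24 * (e * t⁻¹) ^ 2 = 24 * e ^ 2 / t ^ 2 := by field_simp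
  have e2 : 6 * (e * t⁻¹) ^ 2 = 6 * e ^ 2 / t ^ 2 := by field_simp
  constructor
  · rw [e1, le_div_iff₀ (by positivity)]
    nlinarith
  · rw [e2, le_div_iff₀ (by positivity)]
    have : e * t * t ^ 2 = e * t ^ 3 := by ring
    nlinarith

/-- A power `J ^ b` of a nonnegative integrable function belongs to `L^q` when `b q ≤ 1`. -/
theorem memLp_rpow_of_integrable {α : Type*} [MeasurableSpace α] {μ : Measure α}
    [IsFiniteMeasure μ] {J : α → ℝ} (hJ : Integrable J μ) (hJ0 : ∀ x, 0 ≤ J x) {b : ℝ} (hb : 0 ≤ b)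
    {q : ℝ≥0∞} (hq : ENNReal.ofReal b ≤ q⁻¹) : MemLp (fun x => J x ^ b) q μ := by
  rcases hb.eq_or_lt with rfl | hb
  · simpa using memLp_const (1 : ℝ)
  · have h := (memLp_one_iff_integrable.2 hJ).norm_rpow_div (ENNReal.ofReal b)
    rw [ENNReal.toReal_ofReal hb.le] at h
    simp only [Real.norm_of_nonneg (hJ0 _)] at h
    refine h.mono_exponent ?_
    rw [one_div]
    exact ENNReal.le_inv_iff_le_inv.2 hq

/-! ### The example -/

/-- The disc on which the map is considered; `16 ≤ t` on it, which makes `g t ≤ 1 / 16`. -/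
def spiralDisc : Set (EuclideanSpace ℝ (Fin 2)) := Metric.ball 0 (Real.exp (-16))

theorem isOpen_spiralDisc : IsOpen spiralDisc := Metric.isOpen_ball

theorem exp_neg_sixteen_lt_one : Real.exp (-16) < 1 := by
  rw [Real.exp_lt_one_iff]; norm_num

theorem spiralDisc_diff_subset : spiralDisc \ {0} ⊆ Metric.ball 0 1 \ {0} :=
  Set.sdiff_subset_sdiff_left (Metric.ball_subset_ball exp_neg_sixteen_lt_one.le)

theorem le_logRadius {x : EuclideanSpace ℝ (Fin 2)} (hx : x ∈ spiralDisc) (h0 : x ≠ 0) :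
    16 ≤ logRadius x := by
  have h1 := (mem_ball_zero_iff.1 hx).le
  have h2 := (Real.log_le_iff_le_exp (norm_pos_iff.2 h0)).2 h1
  rw [logRadius]; linarith

theorem ae_mem_spiralDisc (a : ℝ) : ∀ᵐ x ∂(volume.restrict spiralDisc),
    x ≠ 0 ∧ 16 ≤ logRadius x ∧ cosPhase a x ≠ 0 := by
  filter_upwards [ae_restrict_of_ae (ae_cosPhase_ne_zero a),
    ae_restrict_of_ae (Measure.ae_ne volume 0),
    ae_restrict_mem isOpen_spiralDisc.measurableSet] with x hx h0 hxΩ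
  exact ⟨h0, le_logRadius hxΩ h0, hx (spiralDisc_diff_subset ⟨hxΩ, h0⟩)⟩

theorem locallyLipschitzOn_spiralMap (a : ℝ) (i : Fin 2) :
    LocallyLipschitzOn (spiralDisc \ {0}) (fun x => spiralMap a x i) := by
  have hP := (locallyLipschitzOn_spiralWave a).mono spiralDisc_diff_subset
  have hr : ∀ {F F' : ℝ → ℝ}, (∀ t, 0 < t → HasStrictDerivAt F (F' t) t) →
      LocallyLipschitzOn (spiralDisc \ {0}) (fun x => F (logRadius x)) := fun h =>
    locallyLipschitzOn_of_hasStrictFDerivAt fun x hx =>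
      hasStrictFDerivAt_comp_logRadius hx.2 (h _ (logRadius_pos (spiralDisc_diff_subset hx)))
  fin_cases i
  · exact (hr fun t ht => Real.hasStrictDerivAt_log ht.ne').add
      ((hr fun t ht => hasStrictDerivAt_amp a ht).mul_real hP)
  · exact ((hr fun t ht => hasStrictDerivAt_width a ht).mul_real hP).neg

theorem continuousOn_spiralMap (a : ℝ) : ContinuousOn (spiralMap a) (spiralDisc \ {0}) := by
  have h : ContinuousOn (fun x => (spiralMap a x).ofLp) (spiralDisc \ {0}) :=
    continuousOn_pi.2 fun i => (locallyLipschitzOn_spiralMap a i).continuousOn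
  exact (PiLp.continuous_toLp 2 _).comp_continuousOn h

instance : IsFiniteMeasure (volume.restrict spiralDisc) :=
  ⟨by rw [Measure.restrict_apply_univ]; exact measure_ball_lt_top⟩

theorem aestronglyMeasurable_spiralMap (a : ℝ) :
    AEStronglyMeasurable (spiralMap a) (volume.restrict spiralDisc) := by
  have h := (continuousOn_spiralMap a).aestronglyMeasurable
    (isOpen_spiralDisc.measurableSet.diff (measurableSet_singleton 0)) (μ := volume)
  rwa [Measure.restrict_congr_set (sdiff_null_ae_eq_self (measure_singleton 0))] at h

theorem integrable_logWeight : Integrable logWeight (volume.restrict spiralDisc) :=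
  integrableOn_logWeight exp_neg_sixteen_lt_one

theorem memLp_spiralMap {a : ℝ} (ha : 1 / 2 ≤ a) :
    MemLp (spiralMap a) 2 (volume.restrict spiralDisc) := by
  have hm := aestronglyMeasurable_spiralMap a
  rw [memLp_two_iff_integrable_sq_norm hm]
  refine (integrable_logWeight.const_mul 24).mono' (hm.norm.pow 2) ?_
  filter_upwards [ae_mem_spiralDisc a] with x ⟨h0, ht, _⟩
  rw [Real.norm_of_nonneg (by positivity)]
  exact (pow_le_pow_left₀ (norm_nonneg _) (norm_spiralMap_le ha ht).1 2).trans
    (logWeight_bounds h0 ht).1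

theorem memLp_fderiv_spiralMap {a : ℝ} (ha : 1 / 2 ≤ a) (ha' : a ≤ 1) :
    MemLp (fderiv ℝ (spiralMap a)) 2 (volume.restrict spiralDisc) := by
  have hm : AEStronglyMeasurable (fderiv ℝ (spiralMap a)) (volume.restrict spiralDisc) :=
    (measurable_fderiv ℝ (spiralMap a)).aestronglyMeasurable
  rw [memLp_two_iff_integrable_sq_norm hm]
  refine (integrable_logWeight.const_mul 36).mono' (hm.norm.pow 2) ?_
  filter_upwards [ae_mem_spiralDisc a] with x ⟨h0, ht, hc⟩
  rw [Real.norm_of_nonneg (by positivity)]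
  refine (pow_le_pow_left₀ (norm_nonneg _) (spiralMap_distortion ha ha' h0 ht hc).1 2).trans ?_
  rw [logWeight]
  exact le_of_eq (by ring)

theorem hasWeakFDerivOn_spiralMap {a : ℝ} (ha : 1 / 2 ≤ a) (ha' : a ≤ 1) :
    HasWeakFDerivOn spiralDisc (spiralMap a) (fderiv ℝ (spiralMap a)) := by
  have hm := aestronglyMeasurable_spiralMap a
  refine hasWeakFDerivOn_fderiv_of_locallyLipschitzOn_diff isOpen_spiralDisc
    (locallyLipschitzOn_spiralMap a) ((memLp_spiralMap ha).integrable one_le_two) ?_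
    ((memLp_fderiv_spiralMap ha ha').integrable one_le_two)
  refine (integrable_logWeight.const_mul 6).mono'
    (measurable_norm.inv.aestronglyMeasurable.smul hm) ?_
  filter_upwards [ae_mem_spiralDisc a] with x ⟨h0, ht, _⟩
  rw [norm_smul, norm_inv, norm_norm]
  exact (mul_le_mul_of_nonneg_left (norm_spiralMap_le ha ht).1 (by positivity)).trans
    (logWeight_bounds h0 ht).2

open Classical in
/-- The distortion function `K`: it exceeds `1` only where the map preserves orientation, so that
the product with a negative determinant costs no more than `|Df|²`. -/
noncomputable def spiralDistortion (a : ℝ) (x : EuclideanSpace ℝ (Fin 2)) : ℝ :=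
  if 0 < (fderiv ℝ (spiralMap a) x).det then max 1 (72 * logWeight x ^ a) else 1

/-- The defect function `Σ`, of the order of the squared derivative where the map is slow. -/
noncomputable def spiralDefect (a : ℝ) (x : EuclideanSpace ℝ (Fin 2)) : ℝ :=
  72 * logWeight x ^ (1 - a)

theorem one_le_spiralDistortion (a : ℝ) (x : EuclideanSpace ℝ (Fin 2)) :
    1 ≤ spiralDistortion a x := by
  unfold spiralDistortion
  split_ifs
  · exact le_max_left _ _
  · exact le_rfl

theorem spiralDistortion_le (a : ℝ) (x : EuclideanSpace ℝ (Fin 2)) :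
    spiralDistortion a x ≤ 1 + 72 * logWeight x ^ a := by
  have h : 0 ≤ logWeight x ^ a := Real.rpow_nonneg (logWeight_nonneg x) a
  unfold spiralDistortion
  split_ifs
  · exact max_le (by linarith) (by linarith)
  · linarith

theorem spiralDefect_nonneg (a : ℝ) (x : EuclideanSpace ℝ (Fin 2)) : 0 ≤ spiralDefect a x :=
  mul_nonneg (by norm_num) (Real.rpow_nonneg (logWeight_nonneg x) _)

theorem measurable_spiralDistortion (a : ℝ) : Measurable (spiralDistortion a) := by
  have hdet : Measurable fun x => (fderiv ℝ (spiralMap a) x).det := by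
    have h : ∀ (v : EuclideanSpace ℝ (Fin 2)) (i : Fin 2),
        Measurable fun x => fderiv ℝ (spiralMap a) x v i := fun v i =>
      (EuclideanSpace.proj i : EuclideanSpace ℝ (Fin 2) →L[ℝ] ℝ).continuous.measurable.comp
        (measurable_fderiv_apply_const ℝ (spiralMap a) v)
    simp only [EuclideanSpace.det_fin_two]
    exact ((h _ _).mul (h _ _)).sub ((h _ _).mul (h _ _))
  exact Measurable.ite (measurableSet_lt measurable_const hdet)
    (measurable_const.max ((measurable_logWeight.pow_const a).const_mul 72)) measurable_const

theorem measurable_spiralDefect (a : ℝ) : Measurable (spiralDefect a) :=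
  (measurable_logWeight.pow_const _).const_mul 72

theorem solvesDistortionInclusion_spiralMap {a : ℝ} (ha : 1 / 2 ≤ a) (ha' : a ≤ 1) :
    SolvesDistortionInclusion spiralDisc (spiralMap a) (spiralDistortion a) (spiralDefect a) := by
  refine ⟨_, hasWeakFDerivOn_spiralMap ha ha', ?_⟩
  filter_upwards [ae_mem_spiralDisc a] with x ⟨h0, ht, hc⟩
  have ht0 : 0 < logRadius x := by linarith
  have hxp : 0 < ‖x‖ := norm_pos_iff.2 h0
  obtain ⟨hn, hdi⟩ := spiralMap_distortion ha ha' h0 ht hc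
  have hS := spiralDefect_nonneg a x
  have hK := one_le_spiralDistortion a x
  have hamp := amp_sq_mul (a := a) h0 ht0
  have hJ : 0 < logWeight x := by unfold logWeight; positivity
  change ‖fderiv ℝ (spiralMap a) x‖ ^ 2 ≤ _
  rcases hdi with hslow | hdet
  · -- the map is slow: the defect controls `|Df|²`, twice over, which absorbs `det Df ≥ -|Df|²`
    have hle : ‖fderiv ℝ (spiralMap a) x‖ ^ 2 ≤ 36 * logWeight x ^ (1 - a) := by
      refine (pow_le_pow_left₀ (norm_nonneg _) hslow 2).trans (le_of_eq ?_)
      rw [← hamp]; ring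
    by_cases hd : 0 < (fderiv ℝ (spiralMap a) x).det
    · have : 0 ≤ spiralDistortion a x * (fderiv ℝ (spiralMap a) x).det := by positivity
      unfold spiralDefect at hS ⊢
      linarith
    · have hb := (abs_le.1 (EuclideanSpace.abs_det_fin_two_le (fderiv ℝ (spiralMap a) x))).1
      rw [spiralDistortion, if_neg hd, spiralDefect]
      linarith
  · -- the map is orientation preserving, with a determinant that is bounded below
    have hd : 0 < (fderiv ℝ (spiralMap a) x).det := by
      have := amp_pos a ht0
      exact lt_of_lt_of_le (by positivity) hdet
    have hle : ‖fderiv ℝ (spiralMap a) x‖ ^ 2 ≤ 36 * logWeight x := by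
      refine (pow_le_pow_left₀ (norm_nonneg _) hn 2).trans (le_of_eq ?_)
      rw [logWeight]; ring
    have hprod : 36 * logWeight x ≤
        72 * logWeight x ^ a * (fderiv ℝ (spiralMap a) x).det := by
      have hmul : logWeight x ^ a * logWeight x ^ (1 - a) = logWeight x := by
        rw [← Real.rpow_add hJ]; simp
      have : logWeight x ^ (1 - a) / 2 ≤ (fderiv ℝ (spiralMap a) x).det := by
        rw [← hamp]; linarith
      calc 36 * logWeight x = 72 * logWeight x ^ a * (logWeight x ^ (1 - a) / 2) := by
            linear_combination (-36 : ℝ) * hmul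
        _ ≤ _ := mul_le_mul_of_nonneg_left this (by positivity)
    have hmax : 72 * logWeight x ^ a ≤ spiralDistortion a x := by
      rw [spiralDistortion, if_pos hd]; exact le_max_right _ _
    have := mul_le_mul_of_nonneg_right hmax hd.le
    linarith

theorem mainTheorem10 (p q : ℝ≥0∞) (hp1 : 1 ≤ p) (hp2 : p ≤ 2) (hq : 1 ≤ q)
    (hpq : 1 ≤ p⁻¹ + q⁻¹) :
    ∃ (Ω : Set (EuclideanSpace ℝ (Fin 2)))
      (f : EuclideanSpace ℝ (Fin 2) → EuclideanSpace ℝ (Fin 2))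
      (K S : EuclideanSpace ℝ (Fin 2) → ℝ),
      IsOpen Ω ∧ IsConnected Ω ∧ (0 : EuclideanSpace ℝ (Fin 2)) ∈ Ω ∧
      MemSobolevOne 2 Ω f ∧
      ContinuousOn f (Ω \ {0}) ∧
      Tendsto (fun x => ‖f x‖) (𝓝[≠] (0 : EuclideanSpace ℝ (Fin 2))) atTop ∧
      Measurable K ∧ Measurable S ∧
      (∀ x ∈ Ω, 1 ≤ K x) ∧ (∀ x ∈ Ω, 0 ≤ S x) ∧
      SolvesDistortionInclusion Ω f K S ∧
      MemLp K p (volume.restrict Ω) ∧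
      MemLp (fun x => S x / K x) q (volume.restrict Ω) ∧
      MemLp S (q / 2) (volume.restrict Ω) := by
  have hpi : p⁻¹ ≠ ⊤ := ENNReal.inv_ne_top.2 (zero_lt_one.trans_le hp1).ne'
  obtain ⟨a, ha⟩ : ∃ a : ℝ, a = p⁻¹.toReal := ⟨_, rfl⟩
  have hofa : ENNReal.ofReal a = p⁻¹ := by rw [ha, ENNReal.ofReal_toReal hpi]
  have ha0 : 0 ≤ a := ha ▸ ENNReal.toReal_nonneg
  have ha1 : a ≤ 1 := by
    have := ENNReal.toReal_mono ENNReal.one_ne_top (ENNReal.inv_le_one.2 hp1)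
    rwa [← ha, ENNReal.toReal_one] at this
  have ha2 : 1 / 2 ≤ a := by
    have := ENNReal.toReal_mono hpi (ENNReal.inv_le_inv.2 hp2)
    rw [← ha, ENNReal.toReal_inv, ENNReal.toReal_ofNat] at this
    linarith
  have hK : MemLp (spiralDistortion a) p (volume.restrict spiralDisc) := by
    have h := (memLp_const (1 : ℝ)).add ((memLp_rpow_of_integrable integrable_logWeight
      logWeight_nonneg ha0 hofa.le).const_mul 72)
    refine h.mono' (measurable_spiralDistortion a).aestronglyMeasurable
      (Eventually.of_forall fun x => ?_)
    rw [Real.norm_of_nonneg (zero_le_one.trans (one_le_spiralDistortion a x))]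
    exact spiralDistortion_le a x
  have hS : MemLp (spiralDefect a) q (volume.restrict spiralDisc) := by
    refine (memLp_rpow_of_integrable integrable_logWeight logWeight_nonneg
      (sub_nonneg.2 ha1) ?_).const_mul 72
    rw [ENNReal.ofReal_sub _ ha0, hofa, ENNReal.ofReal_one]
    exact tsub_le_iff_left.2 hpq
  refine ⟨spiralDisc, spiralMap a, spiralDistortion a, spiralDefect a, isOpen_spiralDisc,
    ?_, Metric.mem_ball_self (Real.exp_pos _),
    ⟨memLp_spiralMap ha2, _, hasWeakFDerivOn_spiralMap ha2 ha1, memLp_fderiv_spiralMap ha2 ha1⟩,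
    continuousOn_spiralMap a, tendsto_norm_spiralMap ha2, measurable_spiralDistortion a,
    measurable_spiralDefect a, fun x _ => one_le_spiralDistortion a x,
    fun x _ => spiralDefect_nonneg a x, solvesDistortionInclusion_spiralMap ha2 ha1, hK, ?_, ?_⟩
  · exact Metric.isConnected_ball (Real.exp_pos _)
  · refine hS.mono ((measurable_spiralDefect a).div
      (measurable_spiralDistortion a)).aestronglyMeasurable (Eventually.of_forall fun x => ?_)
    rw [norm_div]
    refine div_le_self (norm_nonneg _) ?_
    exact (one_le_spiralDistortion a x).trans (le_abs_self _)
  · exact hS.mono_exponent ENNReal.half_le_self
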